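/- Let $N\ge 1$, let $\omega\in\mathbb{C}$ be a primitive $N$-th root of unity and $\mathbb{Z}_N=\mathbb{Z}/N\mathbb{Z}$. Let $X=\mathrm{C}(\mathrm{S}_N^+(\mathrm{R}))$ be the universal unital $\mathrm{C}^*$-algebra with generators $q_{ij}$, $i,j\in\mathbb{Z}_N$, and relations $$q_{0i}=q_{i0}=\delta_{i0},\qquad q_{ij}^*=\omega^{-i(i-j)}q_{-i,-j},$$ $$q_{k,i+j}=\sum_{l}\omega^{-l(i-k+l)}q_{k-l,i}\,q_{lj},\qquad q_{i+j,k}=\sum_{l}\omega^{-i(l-j)}q_{jl}\,q_{i,k-l},$$ with the $\mathbb{Z}_N$-action $\rho_t(q_{ij})=\omega^{t(j-i)}q_{ij}$. Let $\mathrm{C}(\mathbb{Z}_N)$ carry the action $\rho_t(f)(s)=f(s+t)$, and let $z\in\mathrm{C}(\mathbb{Z}_N)$, $z(t)=\omega^t$. For $\mathbb{Z}_N$-$\mathrm{C}^*$-algebras $A$, $B$ represented faithfully and equivariantly on Hilbert spaces $H_A$, $H_B$ with unitary $\mathbb{Z}_N$-representations, let $c:H_A\otimes H_B\to H_B\otimes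 H_A$ be the unitary with $c(\xi\otimes\eta)=\omega^{mn}\,\eta\otimes\xi$ whenever $\mathbb{Z}_N$ acts on $\xi$, $\eta$ by $t\mapsto\omega^{tm}$, $t\mapsto\omega^{tn}$. The braided tensor product $A\boxtimes_{\mathrm R}B$ is the $\mathrm{C}^*$-algebra of operators on $H_A\otimes H_B$ generated by $j_1(x)=x\otimes 1$, $x\in A$, and $j_2(y)=c^*(y\otimes 1)c$, $y\in B$, with the action implemented by the tensor product of the two representations. Here $\mathrm{C}(\mathbb{Z}_N)$ is represented on $\ell^2(\mathbb{Z}_N)$ by multiplication, and $X$ by an arbitrary faithful equivariant representation. Let $\otimes$ be the minimal tensor product and $$A_{\rtimes}=\mathrm{C}(\mathrm{S}_N^+(\mathrm{R})\rtimes\mathbb{Z}_N)=\mathrm{C}(\mathbb{Z}_N)\boxtimes_{\mathrm R}X .$$ There is exactly one unital $*$-homomorphism $\Delta_{\rtimes}:A_{\rtimes}\to A_{\rtimes}\otimes A_{\rtimes}$ of the form $\Delta_{\rtimes}=\psi\circ(\mathrm{id}\boxtimes_{\mathrm R}\Delta)$, where $\Delta:X\to X\boxtimes_{\mathrm R}X$,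 $\mathrm{id}\boxtimes_{\mathrm R}\Delta:A_{\rtimes}\to\mathrm{C}(\mathbb{Z}_N)\boxtimes_{\mathrm R}X\boxtimes_{\mathrm R}X$ and $\psi:\mathrm{C}(\mathbb{Z}_N)\boxtimes_{\mathrm R}X\boxtimes_{\mathrm R}X\to A_{\rtimes}\otimes A_{\rtimes}$ are unital $*$-homomorphisms with $\Delta(q_{ij})=\sum_k j_1(q_{ik})j_2(q_{kj})$, $(\mathrm{id}\boxtimes_{\mathrm R}\Delta)(j_1(x)j_2(a))=j_1(x)j_2(\Delta(a))$, and $$\psi(j_1(x))=(j_1\otimes j_1)(\Delta_{\mathbb{Z}_N}(x)),\quad \psi(j_2(a))=(j_2\otimes j_1)(\rho^X(a)),\quad \psi(j_3(b))=1\otimes j_2(b)$$ for $x\in\mathrm{C}(\mathbb{Z}_N)$, $a,b\in X$, where $\Delta_{\mathbb{Z}_N}(x)=\sum_{s,t}x(s+t)\,\delta_s\otimes\delta_t$ and $\rho^X(a)=\sum_t\rho_t(a)\otimes\delta_t$. This $\Delta_{\rtimes}$ is the comultiplication of the bosonization $\mathrm{S}_N^+(\mathrm{R})\rtimes\mathbb{Z}_N$.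 Put $t_{ij}=j_1(z^i)j_2(q_{ij})\in A_{\rtimes}$ for $i,j\in\mathbb{Z}_N$. Then the matrix $t=(t_{ij})$ is a finite-dimensional unitary representation of the bosonization, i.e. $t$ is unitary in $M_N(A_{\rtimes})$ and $\Delta_{\rtimes}(t_{ij})=\sum_k t_{ik}\otimes t_{kj}$. Moreover, writing $z$ for $j_1(z)$, the pair $(A_{\rtimes},\,z\oplus t)$ is a compact matrix quantum group with comultiplication $\Delta_{\rtimes}$: the entries of $u=z\oplus t\in M_{1+N}(A_{\rtimes})$ generate a dense $*$-subalgebra of $A_{\rtimes}$, $\Delta_{\rtimes}(u_{kl})=\sum_m u_{km}\otimes u_{ml}$, and $u$ and $\overline u=(u_{kl}^*)$ are invertible. -/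

import Mathlib

open scoped TensorProduct

universe u v

noncomputable section

/-! ### The free unital complex `*`-algebra -/

/-- The free unital complex `*`-algebra on a set `G` of generators: noncommutative polynomials in
the letters `Sum.inl g` (the generator `g`) and `Sum.inr g` (its formal adjoint). -/
def FreeStarAlg (G : Type) : Type := FreeAlgebra ℂ (G ⊕ G)

namespace FreeStarAlg

variable {G : Type}

instance : Ring (FreeStarAlg G) := inferInstanceAs (Ring (FreeAlgebra ℂ (G ⊕ G)))

instance : Algebra ℂ (FreeStarAlg G) := inferInstanceAs (Algebra ℂ (FreeAlgebra ℂ (G ⊕ G)))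

/-- The letters: generators and their formal adjoints. -/
def letter (x : G ⊕ G) : FreeStarAlg G := FreeAlgebra.ι ℂ x

/-- The generators. -/
def gen (g : G) : FreeStarAlg G := letter (Sum.inl g)

theorem induction {motive : FreeStarAlg G → Prop}
    (scalar : ∀ r : ℂ, motive (algebraMap ℂ (FreeStarAlg G) r))
    (letter : ∀ x, motive (letter x))
    (mul : ∀ a b, motive a → motive b → motive (a * b))
    (add : ∀ a b, motive a → motive b → motive (a + b)) (a : FreeStarAlg G) : motive a :=
  FreeAlgebra.induction (R := ℂ) (X := G ⊕ G) (motive := motive) scalar letter mul add a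

/-- The opposite ring, on which a scalar acts through its complex conjugate. -/
abbrev conjAlgebra : Algebra ℂ (FreeStarAlg G)ᵐᵒᵖ :=
  Algebra.compHom (FreeStarAlg G)ᵐᵒᵖ (starRingEnd ℂ)

/-- The involution as a ring homomorphism into the opposite ring: it is conjugate-linear and swaps
the generators with their formal adjoints. -/
def starHom : FreeStarAlg G →+* (FreeStarAlg G)ᵐᵒᵖ :=
  letI := conjAlgebra (G := G)
  (FreeAlgebra.lift ℂ (fun x : G ⊕ G => MulOpposite.op (letter x.swap))).toRingHom

theorem starHom_letter (x : G ⊕ G) : starHom (letter x) = MulOpposite.op (letter x.swap) :=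
  letI := conjAlgebra (G := G)
  FreeAlgebra.lift_ι_apply (R := ℂ) (fun x : G ⊕ G => MulOpposite.op (letter x.swap)) x

theorem starHom_algebraMap (r : ℂ) : starHom (algebraMap ℂ (FreeStarAlg G) r)
    = MulOpposite.op (algebraMap ℂ (FreeStarAlg G) (starRingEnd ℂ r)) :=
  letI := conjAlgebra (G := G)
  (FreeAlgebra.lift ℂ (fun x : G ⊕ G => MulOpposite.op (letter x.swap))).commutes r

instance : StarRing (FreeStarAlg G) where
  star a := (starHom a).unop
  star_involutive a := by
    induction a using induction with
    | scalar r => simp [starHom_algebraMap]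
    | letter x => simp [starHom_letter]
    | mul a b ha hb => simp [ha, hb]
    | add a b ha hb => simp [ha, hb]
  star_mul a b := by simp
  star_add a b := by simp

theorem star_letter (x : G ⊕ G) : star (letter x) = letter x.swap := by
  change (starHom (letter x)).unop = _
  simp [starHom_letter]

theorem star_algebraMap' (r : ℂ) :
    star (algebraMap ℂ (FreeStarAlg G) r) = algebraMap ℂ (FreeStarAlg G) (star r) := by
  change (starHom _).unop = _
  simp [starHom_algebraMap]

instance : StarModule ℂ (FreeStarAlg G) where
  star_smul r a := by
    rw [Algebra.smul_def, star_mul, star_algebraMap', Algebra.smul_def, Algebra.commutes]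

end FreeStarAlg

/-! ### `C*`-seminorms and their completions -/

/-- A `C*`-seminorm on a complex `*`-algebra. -/
structure CStarSeminorm (F : Type) [Ring F] [StarRing F] [Algebra ℂ F] extends Seminorm ℂ F where
  mul_le' : ∀ a b : F, toFun (a * b) ≤ toFun a * toFun b
  star_mul_self' : ∀ a : F, toFun (star a * a) = toFun a * toFun a

namespace CStarSeminorm

variable {F : Type} [Ring F] [StarRing F] [Algebra ℂ F] (p : CStarSeminorm F)

theorem star_mul_self (a : F) : p.toSeminorm (star a * a) = p.toSeminorm a * p.toSeminorm a :=
  p.star_mul_self' a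

theorem mul_le (a b : F) : p.toSeminorm (a * b) ≤ p.toSeminorm a * p.toSeminorm b := p.mul_le' a b

theorem le_star (a : F) : p.toSeminorm a ≤ p.toSeminorm (star a) := by
  rcases (apply_nonneg p.toSeminorm a).eq_or_lt with h | h
  · rw [← h]; exact apply_nonneg _ _
  · have := p.mul_le (star a) a
    rw [p.star_mul_self] at this
    exact le_of_mul_le_mul_right this h

theorem map_star (a : F) : p.toSeminorm (star a) = p.toSeminorm a :=
  le_antisymm (by simpa using p.le_star (star a)) (p.le_star a)

/-- The `*`-algebra `F`, seminormed by `p`. -/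
@[nolint unusedArguments]
def Space (_ : CStarSeminorm F) : Type := F

instance : Ring p.Space := inferInstanceAs (Ring F)
instance : StarRing p.Space := inferInstanceAs (StarRing F)
instance : Algebra ℂ p.Space := inferInstanceAs (Algebra ℂ F)

instance : SeminormedRing p.Space where
  __ : Ring p.Space := inferInstance
  __ : SeminormedAddCommGroup p.Space :=
    p.toSeminorm.toAddGroupSeminorm.toSeminormedAddCommGroup
  norm_mul_le a b := p.mul_le a b

theorem norm_def (a : p.Space) : ‖a‖ = p.toSeminorm (show F from a) := rfl

instance : NormedAlgebra ℂ p.Space where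
  norm_smul_le r a := (map_smul_eq_mul p.toSeminorm r (show F from a)).le

instance : NormedStarGroup p.Space where
  norm_star_le a := (p.map_star (show F from a)).le

/-- The separated completion of `F` with respect to `p`. -/
def Compl : Type := UniformSpace.Completion p.Space

instance : NormedRing p.Compl := inferInstanceAs (NormedRing (UniformSpace.Completion p.Space))
instance : NormedSpace ℂ p.Compl :=
  inferInstanceAs (NormedSpace ℂ (UniformSpace.Completion p.Space))
instance : Algebra ℂ p.Compl := inferInstanceAs (Algebra ℂ (UniformSpace.Completion p.Space))
instance : CompleteSpace p.Compl :=
  inferInstanceAs (CompleteSpace (UniformSpace.Completion p.Space))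

instance : NormedAlgebra ℂ p.Compl where
  norm_smul_le := norm_smul_le (α := ℂ) (β := UniformSpace.Completion p.Space)

/-- The canonical map from `F` to the completion. -/
def toCompl (a : F) : p.Compl := ((show p.Space from a : p.Space) : UniformSpace.Completion p.Space)

@[elab_as_elim]
theorem induction_on {motive : p.Compl → Prop} (x : p.Compl) (hc : IsClosed {x | motive x})
    (h : ∀ a : F, motive (p.toCompl a)) : motive x :=
  UniformSpace.Completion.induction_on x hc h

theorem norm_toCompl (a : F) : ‖p.toCompl a‖ = p.toSeminorm a :=
  UniformSpace.Completion.norm_coe (E := p.Space) _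

theorem toCompl_mul (a b : F) : p.toCompl (a * b) = p.toCompl a * p.toCompl b :=
  UniformSpace.Completion.coe_mul (α := p.Space) _ _

theorem toCompl_add (a b : F) : p.toCompl (a + b) = p.toCompl a + p.toCompl b :=
  UniformSpace.Completion.coe_add (α := p.Space) _ _

theorem toCompl_sub (a b : F) : p.toCompl (a - b) = p.toCompl a - p.toCompl b :=
  UniformSpace.Completion.coe_sub (α := p.Space) _ _

theorem toCompl_one : p.toCompl 1 = 1 := rfl

theorem toCompl_zero : p.toCompl 0 = 0 := rfl

theorem toCompl_smul (r : ℂ) (a : F) : p.toCompl (r • a) = r • p.toCompl a := by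
  rw [Algebra.smul_def, Algebra.smul_def, toCompl_mul]
  rfl

instance : Star p.Compl := ⟨UniformSpace.Completion.map (star : p.Space → p.Space)⟩

theorem uniformContinuous_star_space : UniformContinuous (star : p.Space → p.Space) :=
  (star_isometry (E := p.Space)).uniformContinuous

theorem star_toCompl (a : F) : star (p.toCompl a) = p.toCompl (star a) :=
  UniformSpace.Completion.map_coe p.uniformContinuous_star_space _

theorem continuous_star_compl : Continuous (star : p.Compl → p.Compl) :=
  UniformSpace.Completion.continuous_map

instance : ContinuousStar p.Compl := ⟨p.continuous_star_compl⟩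

instance : StarRing p.Compl where
  star_involutive x := by
    induction x using p.induction_on with
    | hc => exact isClosed_eq (by fun_prop) (by fun_prop)
    | h a => rw [star_toCompl, star_toCompl, star_star]
  star_mul x y := by
    induction x using p.induction_on with
    | hc => exact isClosed_eq (by fun_prop) (by fun_prop)
    | h a =>
      induction y using p.induction_on with
      | hc => exact isClosed_eq (by fun_prop) (by fun_prop)
      | h b => simp only [← toCompl_mul, star_toCompl, star_mul]
  star_add x y := by
    induction x using p.induction_on with
    | hc => exact isClosed_eq (by fun_prop) (by fun_prop)
    | h a =>
      induction y using p.induction_on with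
      | hc => exact isClosed_eq (by fun_prop) (by fun_prop)
      | h b => simp only [← toCompl_add, star_toCompl, star_add]

instance [StarModule ℂ F] : StarModule ℂ p.Compl where
  star_smul r x := by
    have h : star (algebraMap ℂ p.Compl r) = algebraMap ℂ p.Compl (star r) := by
      change star (p.toCompl (algebraMap ℂ F r)) = p.toCompl (algebraMap ℂ F (star r))
      rw [star_toCompl, algebraMap_star_comm]
    rw [Algebra.smul_def, star_mul, h, Algebra.smul_def, Algebra.commutes]

instance : CStarRing p.Compl where
  norm_mul_self_le x := by
    induction x using p.induction_on with
    | hc => exact isClosed_le (by fun_prop) (by fun_prop)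
    | h a => rw [star_toCompl, ← toCompl_mul, norm_toCompl, norm_toCompl, star_mul_self]

/-- The separated completion of a complex `*`-algebra in a `C*`-seminorm is a `C*`-algebra. -/
instance [StarModule ℂ F] : CStarAlgebra p.Compl where

end CStarSeminorm

/-! ### The `C*`-algebra of the anyonic quantum permutation group -/

/-- `ω ^ a` for a residue `a` modulo `N` (meaningful since `ω ^ N = 1`). -/
def zpw {N : ℕ} (ω : ℂ) (a : ZMod N) : ℂ := ω ^ a.val

/-- The free `*`-algebra on letters `q i j`, `i j ∈ ℤ/N`. -/
abbrev FreeQ (N : ℕ) : Type := FreeStarAlg (ZMod N × ZMod N)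

/-- The letter `q i j`. -/
def fq {N : ℕ} (i j : ZMod N) : FreeQ N := FreeStarAlg.gen (i, j)

/-- The defining relations of the anyonic quantum permutation group; `AnyonicRel N ω x y` says
that `x = y` is one of them. -/
inductive AnyonicRel (N : ℕ) [NeZero N] (ω : ℂ) : FreeQ N → FreeQ N → Prop
  | zero_left (i : ZMod N) : AnyonicRel N ω (fq 0 i) (if i = 0 then 1 else 0)
  | zero_right (i : ZMod N) : AnyonicRel N ω (fq i 0) (if i = 0 then 1 else 0)
  | adj (i j : ZMod N) :
      AnyonicRel N ω (star (fq i j)) (zpw ω (-(i * (i - j))) • fq (-i) (-j))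
  | right (i j k : ZMod N) :
      AnyonicRel N ω (fq k (i + j))
        (∑ l : ZMod N, zpw ω (-(l * (i - k + l))) • (fq (k - l) i * fq l j))
  | left (i j k : ZMod N) :
      AnyonicRel N ω (fq (i + j) k)
        (∑ l : ZMod N, zpw ω (-(i * (l - j))) • (fq j l * fq i (k - l)))

/-- The `C*`-seminorms on the universal `*`-algebra with generators `q i j` and the defining
relations, i.e. those on the free `*`-algebra that respect the relations. -/
def AnyonicSeminorm (N : ℕ) [NeZero N] (ω : ℂ) : Type :=
  {p : CStarSeminorm (FreeQ N) // ∀ x y, AnyonicRel N ω x y → p.toSeminorm (x - y) = 0}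

namespace AnyonicSeminorm

theorem one_le_one {N : ℕ} (p : CStarSeminorm (FreeQ N)) : p.toSeminorm 1 ≤ 1 := by
  have h := p.star_mul_self 1
  rw [star_one, one_mul] at h
  nlinarith [apply_nonneg p.toSeminorm 1]

variable {N : ℕ} [NeZero N] {ω : ℂ}

theorem toCompl_eq (p : AnyonicSeminorm N ω) {x y : FreeQ N} (h : AnyonicRel N ω x y) :
    p.1.toCompl x = p.1.toCompl y := by
  rw [← sub_eq_zero, ← CStarSeminorm.toCompl_sub, ← norm_eq_zero, CStarSeminorm.norm_toCompl]
  exact p.2 x y h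

theorem toCompl_sum (p : CStarSeminorm (FreeQ N)) (f : ZMod N → FreeQ N) :
    p.toCompl (∑ l, f l) = ∑ l, p.toCompl (f l) :=
  map_sum (⟨⟨p.toCompl, p.toCompl_zero⟩, p.toCompl_add⟩ : FreeQ N →+ p.Compl) f Finset.univ

/-- The columns of `q` have length one. -/
theorem sum_star_mul (p : AnyonicSeminorm N ω) (i : ZMod N) :
    ∑ k, star (p.1.toCompl (fq k i)) * p.1.toCompl (fq k i) = 1 := by
  have h := p.toCompl_eq (AnyonicRel.right (ω := ω) (-i) i 0)
  rw [neg_add_cancel, p.toCompl_eq (AnyonicRel.zero_left 0), if_pos rfl, toCompl_sum] at h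
  rw [← p.1.toCompl_one, h]
  refine Finset.sum_congr rfl fun k _ => ?_
  rw [CStarSeminorm.star_toCompl, p.toCompl_eq (AnyonicRel.adj k i), ← CStarSeminorm.toCompl_mul,
    smul_mul_assoc]
  congr 4 <;> ring

theorem norm_le_one_of_sum {A : Type} [CStarAlgebra A] (a : ZMod N → A)
    (h : ∑ k, star (a k) * a k = 1) (k : ZMod N) : ‖a k‖ ≤ 1 := by
  let _ := CStarAlgebra.spectralOrder A
  have := CStarAlgebra.spectralOrderedRing A
  have h1 : star (a k) * a k ≤ 1 := by
    rw [← h]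
    exact Finset.single_le_sum (f := fun k => star (a k) * a k)
      (fun i _ => star_mul_self_nonneg (a i)) (Finset.mem_univ k)
  have h2 : ‖star (a k) * a k‖ ≤ 1 :=
    (CStarAlgebra.norm_le_one_iff_of_nonneg _ (star_mul_self_nonneg (a k))).mpr h1
  rw [CStarRing.norm_star_mul_self] at h2
  nlinarith [norm_nonneg (a k)]

theorem fq_le_one (p : AnyonicSeminorm N ω) (i j : ZMod N) : p.1.toSeminorm (fq i j) ≤ 1 := by
  rw [← CStarSeminorm.norm_toCompl]
  exact norm_le_one_of_sum (fun k => p.1.toCompl (fq k j)) (p.sum_star_mul j) i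

theorem bddAbove (x : FreeQ N) :
    BddAbove (Set.range fun p : AnyonicSeminorm N ω => p.1.toSeminorm x) := by
  suffices h : ∃ C : ℝ, ∀ p : AnyonicSeminorm N ω, p.1.toSeminorm x ≤ C by
    obtain ⟨C, hC⟩ := h
    exact ⟨C, by rintro _ ⟨p, rfl⟩; exact hC p⟩
  induction x using FreeStarAlg.induction with
  | scalar r =>
    refine ⟨‖r‖, fun p => ?_⟩
    rw [Algebra.algebraMap_eq_smul_one, map_smul_eq_mul]
    exact mul_le_of_le_one_right (norm_nonneg r) (one_le_one p.1)
  | letter x =>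
    refine ⟨1, fun p => ?_⟩
    rcases x with x | x
    · exact p.fq_le_one x.1 x.2
    · have h : FreeStarAlg.letter (Sum.inr x) = star (fq x.1 x.2) :=
        (FreeStarAlg.star_letter (Sum.inl x)).symm
      rw [h, p.1.map_star]
      exact p.fq_le_one x.1 x.2
  | mul a b ha hb =>
    obtain ⟨A, hA⟩ := ha
    obtain ⟨B, hB⟩ := hb
    exact ⟨A * B, fun p => (p.1.mul_le a b).trans (mul_le_mul (hA p) (hB p) (apply_nonneg _ _)
      ((apply_nonneg _ _).trans (hA p)))⟩
  | add a b ha hb =>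
    obtain ⟨A, hA⟩ := ha
    obtain ⟨B, hB⟩ := hb
    exact ⟨A + B, fun p => (map_add_le_add p.1.toSeminorm a b).trans (add_le_add (hA p) (hB p))⟩

/-- The zero seminorm. -/
instance : Nonempty (AnyonicSeminorm N ω) :=
  ⟨⟨{ (0 : Seminorm ℂ (FreeQ N)) with
      mul_le' := fun _ _ => (mul_zero (0 : ℝ)).ge
      star_mul_self' := fun _ => (mul_zero (0 : ℝ)).symm }, fun _ _ _ => rfl⟩⟩

end AnyonicSeminorm

/-- The largest `C*`-seminorm on the universal `*`-algebra with generators `q i j` and the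
defining relations of the anyonic quantum permutation group. -/
def maxSeminorm (N : ℕ) [NeZero N] (ω : ℂ) : CStarSeminorm (FreeQ N) where
  toFun x := ⨆ p : AnyonicSeminorm N ω, p.1.toSeminorm x
  map_zero' := by simp
  add_le' x y := ciSup_le fun p => (map_add_le_add p.1.toSeminorm x y).trans
    (add_le_add (le_ciSup (AnyonicSeminorm.bddAbove x) p) (le_ciSup (AnyonicSeminorm.bddAbove y) p))
  neg' x := by simp
  smul' r x := by
    simp only [map_smul_eq_mul]
    exact (Real.mul_iSup_of_nonneg (norm_nonneg r) _).symm
  mul_le' x y := ciSup_le fun p => (p.1.mul_le x y).trans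
    (mul_le_mul (le_ciSup (AnyonicSeminorm.bddAbove x) p) (le_ciSup (AnyonicSeminorm.bddAbove y) p)
      (apply_nonneg _ _) (Real.iSup_nonneg fun p => apply_nonneg _ _))
  star_mul_self' x := by
    have h0 : 0 ≤ ⨆ p : AnyonicSeminorm N ω, p.1.toSeminorm x :=
      Real.iSup_nonneg fun p => apply_nonneg _ _
    apply le_antisymm
    · refine ciSup_le fun p => ?_
      rw [p.1.star_mul_self]
      have h := le_ciSup (AnyonicSeminorm.bddAbove (ω := ω) x) p
      exact mul_le_mul h h (apply_nonneg _ _) h0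
    · rw [Real.mul_iSup_of_nonneg h0]
      refine ciSup_le fun p => ?_
      rw [mul_comm, Real.mul_iSup_of_nonneg (apply_nonneg _ _)]
      refine ciSup_le fun p' => ?_
      rcases le_total (p.1.toSeminorm x) (p'.1.toSeminorm x) with h | h
      · refine le_trans (mul_le_mul_of_nonneg_right h (apply_nonneg _ _)) ?_
        rw [← p'.1.star_mul_self]
        exact le_ciSup (AnyonicSeminorm.bddAbove (ω := ω) (star x * x)) p'
      · refine le_trans (mul_le_mul_of_nonneg_left h (apply_nonneg _ _)) ?_
        rw [← p.1.star_mul_self]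
        exact le_ciSup (AnyonicSeminorm.bddAbove (ω := ω) (star x * x)) p

/-- The universal unital `C*`-algebra `C(S_N⁺(R))` with generators `q i j` and the defining
relations of the anyonic quantum permutation group. -/
def CS (N : ℕ) [NeZero N] (ω : ℂ) : Type := (maxSeminorm N ω).Compl

instance (N : ℕ) [NeZero N] (ω : ℂ) : CStarAlgebra (CS N ω) :=
  inferInstanceAs (CStarAlgebra (maxSeminorm N ω).Compl)

/-- The canonical generators `q i j` of `C(S_N⁺(R))`. -/
def q {N : ℕ} [NeZero N] (ω : ℂ) (i j : ZMod N) : CS N ω := (maxSeminorm N ω).toCompl (fq i j)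

theorem CS.induction {N : ℕ} [NeZero N] {ω : ℂ} (S : StarSubalgebra ℂ (CS N ω))
    (hc : IsClosed (S : Set (CS N ω))) (hq : ∀ i j, q ω i j ∈ S) (a : CS N ω) : a ∈ S := by
  refine (maxSeminorm N ω).induction_on (motive := fun a => a ∈ S) a hc fun x => ?_
  induction x using FreeStarAlg.induction with
  | scalar r => exact S.algebraMap_mem r
  | letter x =>
    rcases x with x | x
    · exact hq x.1 x.2
    · have h : FreeStarAlg.letter (Sum.inr x) = star (fq x.1 x.2) :=
        (FreeStarAlg.star_letter (Sum.inl x)).symm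
      rw [h, ← CStarSeminorm.star_toCompl]
      have h' : star (q ω x.1 x.2) ∈ S := star_mem (hq x.1 x.2)
      exact h'
  | mul a b ha hb =>
    rw [CStarSeminorm.toCompl_mul]
    exact mul_mem ha hb
  | add a b ha hb =>
    rw [CStarSeminorm.toCompl_add]
    exact add_mem ha hb

/-! ### Tensor products of Hilbert spaces, of operators and of concrete `C*`-algebras -/

/-- The tensor product of two Hilbert spaces: the completion of the algebraic tensor product. -/
def HTensor (H : Type u) (K : Type v) [NormedAddCommGroup H] [InnerProductSpace ℂ H]
    [NormedAddCommGroup K] [InnerProductSpace ℂ K] : Type (max u v) :=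
  UniformSpace.Completion (H ⊗[ℂ] K)

section OpTensor

variable {H H' H'' : Type*} {K K' K'' : Type*}
  [NormedAddCommGroup H] [InnerProductSpace ℂ H]
  [NormedAddCommGroup H'] [InnerProductSpace ℂ H']
  [NormedAddCommGroup H''] [InnerProductSpace ℂ H'']
  [NormedAddCommGroup K] [InnerProductSpace ℂ K]
  [NormedAddCommGroup K'] [InnerProductSpace ℂ K']
  [NormedAddCommGroup K''] [InnerProductSpace ℂ K'']

instance : NormedAddCommGroup (HTensor H K) :=
  inferInstanceAs (NormedAddCommGroup (UniformSpace.Completion (H ⊗[ℂ] K)))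

instance : InnerProductSpace ℂ (HTensor H K) :=
  inferInstanceAs (InnerProductSpace ℂ (UniformSpace.Completion (H ⊗[ℂ] K)))

instance : CompleteSpace (HTensor H K) :=
  inferInstanceAs (CompleteSpace (UniformSpace.Completion (H ⊗[ℂ] K)))

/-- The isometric inclusion of the algebraic tensor product. -/
def HTensor.incl (H K : Type*) [NormedAddCommGroup H] [InnerProductSpace ℂ H]
    [NormedAddCommGroup K] [InnerProductSpace ℂ K] : H ⊗[ℂ] K →ₗᵢ[ℂ] HTensor H K :=
  (UniformSpace.Completion.toComplₗᵢ :
    H ⊗[ℂ] K →ₗᵢ[ℂ] UniformSpace.Completion (H ⊗[ℂ] K))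

/-- The elementary tensor `x ⊗ y`. -/
def HTensor.tmul (x : H) (y : K) : HTensor H K := HTensor.incl H K (x ⊗ₜ[ℂ] y)

/-- The tensor product `a ⊗ b` of two bounded operators. -/
def opTensor (a : H →L[ℂ] H') (b : K →L[ℂ] K') : HTensor H K →L[ℂ] HTensor H' K' :=
  ((TensorProduct.mapL a b).completion :
    UniformSpace.Completion (H ⊗[ℂ] K) →L[ℂ] UniformSpace.Completion (H' ⊗[ℂ] K'))

/-- The flip `ξ ⊗ η ↦ η ⊗ ξ`. -/
def flipOp (H K : Type*) [NormedAddCommGroup H] [InnerProductSpace ℂ H]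
    [NormedAddCommGroup K] [InnerProductSpace ℂ K] : HTensor H K →L[ℂ] HTensor K H :=
  ((TensorProduct.commIsometry ℂ H K).toLinearIsometry.toContinuousLinearMap.completion :
    UniformSpace.Completion (H ⊗[ℂ] K) →L[ℂ] UniformSpace.Completion (K ⊗[ℂ] H))

@[elab_as_elim]
theorem HTensor.induction {motive : HTensor H K → Prop} (v : HTensor H K)
    (closed : IsClosed {v | motive v}) (zero : motive 0)
    (tmul : ∀ (x : H) (y : K), motive (HTensor.tmul x y))
    (add : ∀ v w, motive v → motive w → motive (v + w)) : motive v := by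
  refine UniformSpace.Completion.induction_on (α := H ⊗[ℂ] K) v closed fun v => ?_
  change motive (HTensor.incl H K v)
  induction v with
  | zero => rw [map_zero]; exact zero
  | tmul x y => exact tmul x y
  | add v w hv hw => rw [map_add]; exact add _ _ hv hw

theorem HTensor.inner_tmul (x x' : H) (y y' : K) :
    inner ℂ (HTensor.tmul x y) (HTensor.tmul x' y') = inner ℂ x x' * inner ℂ y y' := by
  rw [HTensor.tmul, HTensor.tmul, LinearIsometry.inner_map_map, TensorProduct.inner_tmul]

theorem HTensor.ext {L : Type*} [NormedAddCommGroup L] [InnerProductSpace ℂ L]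
    {S T : HTensor H K →L[ℂ] L}
    (h : ∀ (x : H) (y : K), S (HTensor.tmul x y) = T (HTensor.tmul x y)) : S = T := by
  refine ContinuousLinearMap.ext fun v => ?_
  induction v using HTensor.induction with
  | closed => exact isClosed_eq S.continuous T.continuous
  | zero => simp
  | tmul x y => exact h x y
  | add v w hv hw => rw [map_add, map_add, hv, hw]

@[simp] theorem opTensor_tmul (a : H →L[ℂ] H') (b : K →L[ℂ] K') (x : H) (y : K) :
    opTensor a b (HTensor.tmul x y) = HTensor.tmul (a x) (b y) :=
  (TensorProduct.mapL a b).completion_apply_coe (x ⊗ₜ[ℂ] y)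

@[simp] theorem flipOp_tmul (x : H) (y : K) :
    flipOp H K (HTensor.tmul x y) = HTensor.tmul y x :=
  (TensorProduct.commIsometry ℂ H K).toLinearIsometry.toContinuousLinearMap.completion_apply_coe
    (x ⊗ₜ[ℂ] y)

theorem opTensor_comp (a : H' →L[ℂ] H'') (a' : H →L[ℂ] H') (b : K' →L[ℂ] K'') (b' : K →L[ℂ] K') :
    opTensor a b ∘L opTensor a' b' = opTensor (a ∘L a') (b ∘L b') :=
  HTensor.ext fun x y => by simp

theorem opTensor_mul (a a' : H →L[ℂ] H) (b b' : K →L[ℂ] K) :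
    opTensor a b * opTensor a' b' = opTensor (a * a') (b * b') :=
  opTensor_comp a a' b b'

theorem opTensor_one : opTensor (1 : H →L[ℂ] H) (1 : K →L[ℂ] K) = 1 :=
  HTensor.ext fun x y => by simp

theorem opTensor_flipOp (a : H →L[ℂ] H') (b : K →L[ℂ] K') :
    flipOp H' K' ∘L opTensor a b = opTensor b a ∘L flipOp H K :=
  HTensor.ext fun x y => by simp

theorem star_opTensor [CompleteSpace H] [CompleteSpace K] (a : H →L[ℂ] H) (b : K →L[ℂ] K) :
    star (opTensor a b) = opTensor (star a) (star b) := by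
  symm
  rw [ContinuousLinearMap.star_eq_adjoint (opTensor a b), ContinuousLinearMap.eq_adjoint_iff]
  intro v w
  induction v using HTensor.induction with
  | closed => exact isClosed_eq (by fun_prop) (by fun_prop)
  | zero => simp
  | add v v' hv hv' => rw [map_add, inner_add_left, inner_add_left, hv, hv']
  | tmul x y =>
    induction w using HTensor.induction with
    | closed => exact isClosed_eq (by fun_prop) (by fun_prop)
    | zero => simp
    | add w w' hw hw' => rw [map_add, inner_add_right, inner_add_right, hw, hw']
    | tmul x' y' =>
      simp [ContinuousLinearMap.star_eq_adjoint, ContinuousLinearMap.adjoint_inner_left,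
        HTensor.inner_tmul]

/-- The tensor product of two unitaries. -/
def unitaryTensor [CompleteSpace H] [CompleteSpace K] (u : unitary (H →L[ℂ] H))
    (w : unitary (K →L[ℂ] K)) : unitary (HTensor H K →L[ℂ] HTensor H K) :=
  ⟨opTensor (u : H →L[ℂ] H) (w : K →L[ℂ] K), by
    rw [Unitary.mem_iff, star_opTensor, opTensor_mul, opTensor_mul,
      Unitary.star_mul_self_of_mem u.2, Unitary.star_mul_self_of_mem w.2,
      Unitary.mul_star_self_of_mem u.2, Unitary.mul_star_self_of_mem w.2, opTensor_one]
    exact ⟨rfl, rfl⟩⟩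

/-- The minimal tensor product `A ⊗ B` of two concrete unital `C*`-algebras: the `C*`-algebra of
operators generated by the elementary tensors `a ⊗ b`. -/
def minTensor [CompleteSpace H] [CompleteSpace K] (A : StarSubalgebra ℂ (H →L[ℂ] H))
    (B : StarSubalgebra ℂ (K →L[ℂ] K)) : StarSubalgebra ℂ (HTensor H K →L[ℂ] HTensor H K) :=
  (StarAlgebra.adjoin ℂ
    {T | ∃ a ∈ A, ∃ b ∈ B, T = opTensor a b}).topologicalClosure

/-- The elementary tensor `a ⊗ b` as an element of the minimal tensor product. -/
def minTensor.tmul [CompleteSpace H] [CompleteSpace K] {A : StarSubalgebra ℂ (H →L[ℂ] H)}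
    {B : StarSubalgebra ℂ (K →L[ℂ] K)} (a : A) (b : B) : minTensor A B :=
  ⟨opTensor (a : H →L[ℂ] H) (b : K →L[ℂ] K), StarSubalgebra.le_topologicalClosure _
    (StarAlgebra.subset_adjoin ℂ _ ⟨a, a.2, b, b.2, rfl⟩)⟩

end OpTensor

/-! ### `ℤ/N`-`C*`-algebras and the braided tensor product -/

theorem conj_mem_closure {A : Type*} [CStarAlgebra A] (S : Set A) (w : unitary A)
    (h : ∀ a ∈ S, Unitary.conjStarAlgAut ℂ A w a ∈
      (StarAlgebra.adjoin ℂ S).topologicalClosure) (a : A)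
    (ha : a ∈ (StarAlgebra.adjoin ℂ S).topologicalClosure) :
    Unitary.conjStarAlgAut ℂ A w a ∈ (StarAlgebra.adjoin ℂ S).topologicalClosure := by
  have hφ : Continuous ((Unitary.conjStarAlgAut ℂ A w : A →⋆ₐ[ℂ] A)) := by
    change Continuous fun a : A => (w : A) * a * ((star w : unitary A) : A)
    fun_prop
  suffices h' : (StarAlgebra.adjoin ℂ S).topologicalClosure ≤
      ((StarAlgebra.adjoin ℂ S).topologicalClosure).comap
        (Unitary.conjStarAlgAut ℂ A w : A →⋆ₐ[ℂ] A) from h' ha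
  exact StarSubalgebra.topologicalClosure_minimal (StarAlgebra.adjoin_le h)
    ((StarSubalgebra.isClosed_topologicalClosure _).preimage hφ)

/-- A `ℤ/N`-`C*`-algebra, given together with a faithful equivariant representation: a unital
`C*`-algebra `A` of operators on a Hilbert space `H` and a unitary representation `U` of `ℤ/N` on
`H` with `U t A (U t)* ⊆ A`. The `ℤ/N`-action is `ρ_t(a) = U t a (U t)*`. -/
structure ZNAlg (N : ℕ) where
  H : Type u
  [normedAddCommGroup : NormedAddCommGroup H]
  [innerProductSpace : InnerProductSpace ℂ H]
  [completeSpace : CompleteSpace H]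
  U : Multiplicative (ZMod N) →* unitary (H →L[ℂ] H)
  A : StarSubalgebra ℂ (H →L[ℂ] H)
  isClosed : IsClosed (A : Set (H →L[ℂ] H))
  conj_mem : ∀ t, ∀ a ∈ A, Unitary.conjStarAlgAut ℂ (H →L[ℂ] H) (U t) a ∈ A

attribute [instance] ZNAlg.normedAddCommGroup ZNAlg.innerProductSpace ZNAlg.completeSpace

namespace ZNAlg

variable {N : ℕ}

/-- The action `ρ_t(a) = U t a (U t)*` of `t ∈ ℤ/N`. -/
def act (X : ZNAlg.{u} N) (t : ZMod N) (a : X.A) : X.A :=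
  ⟨Unitary.conjStarAlgAut ℂ (X.H →L[ℂ] X.H) (X.U (Multiplicative.ofAdd t)) a,
    X.conj_mem _ a a.2⟩

/-- The operator `j₁(x) = x ⊗ 1`. -/
def opj₁ (X : ZNAlg.{u} N) (Y : ZNAlg.{v} N) (x : X.H →L[ℂ] X.H) :
    HTensor X.H Y.H →L[ℂ] HTensor X.H Y.H :=
  opTensor x 1

theorem conj_opj₁ (X : ZNAlg.{u} N) (Y : ZNAlg.{v} N) (t : Multiplicative (ZMod N))
    (x : X.H →L[ℂ] X.H) :
    Unitary.conjStarAlgAut ℂ _ (unitaryTensor (X.U t) (Y.U t)) (opj₁ X Y x)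
      = opj₁ X Y (Unitary.conjStarAlgAut ℂ _ (X.U t) x) := by
  rw [Unitary.conjStarAlgAut_apply, Unitary.conjStarAlgAut_apply]
  simp only [opj₁, unitaryTensor, star_opTensor, opTensor_mul, mul_one,
    Unitary.mul_star_self_of_mem (Y.U t).2]

variable [NeZero N] (ω : ℂ)

/-- The orthogonal projection of `H` onto the eigenspace
`{ξ | U t ξ = ω ^ (t * m) ξ for all t}`. -/
def proj (X : ZNAlg.{u} N) (m : ZMod N) : X.H →L[ℂ] X.H :=
  (N : ℂ)⁻¹ • ∑ t : ZMod N, zpw ω (-(t * m)) •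
    (X.U (Multiplicative.ofAdd t) : X.H →L[ℂ] X.H)

/-- The braiding unitary `c : H_X ⊗ H_Y → H_Y ⊗ H_X`, `ξ ⊗ η ↦ ω ^ (m * n) η ⊗ ξ` for eigenvectors
`ξ`, `η` of weights `m`, `n`. -/
def braid (X : ZNAlg.{u} N) (Y : ZNAlg.{v} N) : HTensor X.H Y.H →L[ℂ] HTensor Y.H X.H :=
  (∑ m : ZMod N, ∑ n : ZMod N, zpw ω (m * n) • opTensor (Y.proj ω n) (X.proj ω m)) ∘L
    flipOp X.H Y.H

/-- The dual braiding unitary `H_Y ⊗ H_X → H_X ⊗ H_Y`, `η ⊗ ξ ↦ ω ^ (-(m * n)) ξ ⊗ η` for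
eigenvectors `ξ`, `η` of weights `m`, `n`. -/
def dualBraid (X : ZNAlg.{u} N) (Y : ZNAlg.{v} N) : HTensor Y.H X.H →L[ℂ] HTensor X.H Y.H :=
  (∑ m : ZMod N, ∑ n : ZMod N, zpw ω (-(m * n)) • opTensor (X.proj ω m) (Y.proj ω n)) ∘L
    flipOp Y.H X.H

/-- The operator `j₂(y) = c* (y ⊗ 1) c`. -/
def opj₂ (X : ZNAlg.{u} N) (Y : ZNAlg.{v} N) (y : Y.H →L[ℂ] Y.H) :
    HTensor X.H Y.H →L[ℂ] HTensor X.H Y.H :=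
  dualBraid ω X Y ∘L opTensor y 1 ∘L braid ω X Y

/-- The operators generating the braided tensor product. -/
def boxGens (X : ZNAlg.{u} N) (Y : ZNAlg.{v} N) : Set (HTensor X.H Y.H →L[ℂ] HTensor X.H Y.H) :=
  {T | (∃ x ∈ X.A, T = opj₁ X Y x) ∨ ∃ y ∈ Y.A, T = opj₂ ω X Y y}

theorem proj_comm (X : ZNAlg.{u} N) (t : Multiplicative (ZMod N)) (m : ZMod N) :
    (X.U t : X.H →L[ℂ] X.H) * X.proj ω m = X.proj ω m * (X.U t : X.H →L[ℂ] X.H) := by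
  simp only [proj, mul_smul_comm, smul_mul_assoc, Finset.mul_sum, Finset.sum_mul]
  congr 1
  refine Finset.sum_congr rfl fun s _ => ?_
  rw [← Submonoid.coe_mul, ← Submonoid.coe_mul, ← map_mul, ← map_mul,
    mul_comm t (Multiplicative.ofAdd s)]

theorem dualBraid_comm (X : ZNAlg.{u} N) (Y : ZNAlg.{v} N) (t : Multiplicative (ZMod N)) :
    opTensor (X.U t : X.H →L[ℂ] X.H) (Y.U t : Y.H →L[ℂ] Y.H) ∘L dualBraid ω X Y
      = dualBraid ω X Y ∘L opTensor (Y.U t : Y.H →L[ℂ] Y.H) (X.U t : X.H →L[ℂ] X.H) := by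
  rw [dualBraid, ContinuousLinearMap.comp_assoc, opTensor_flipOp,
    ← ContinuousLinearMap.comp_assoc, ← ContinuousLinearMap.comp_assoc]
  congr 1
  simp only [← ContinuousLinearMap.mul_def, Finset.mul_sum, Finset.sum_mul, mul_smul_comm,
    smul_mul_assoc, opTensor_mul, proj_comm]

theorem braid_comm (X : ZNAlg.{u} N) (Y : ZNAlg.{v} N) (t : Multiplicative (ZMod N)) :
    opTensor (Y.U t : Y.H →L[ℂ] Y.H) (X.U t : X.H →L[ℂ] X.H) ∘L braid ω X Y
      = braid ω X Y ∘L opTensor (X.U t : X.H →L[ℂ] X.H) (Y.U t : Y.H →L[ℂ] Y.H) := by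
  rw [braid, ContinuousLinearMap.comp_assoc, opTensor_flipOp,
    ← ContinuousLinearMap.comp_assoc, ← ContinuousLinearMap.comp_assoc]
  congr 1
  simp only [← ContinuousLinearMap.mul_def, Finset.mul_sum, Finset.sum_mul, mul_smul_comm,
    smul_mul_assoc, opTensor_mul, proj_comm]

theorem conj_opj₂ (X : ZNAlg.{u} N) (Y : ZNAlg.{v} N) (t : Multiplicative (ZMod N))
    (y : Y.H →L[ℂ] Y.H) :
    Unitary.conjStarAlgAut ℂ _ (unitaryTensor (X.U t) (Y.U t)) (opj₂ ω X Y y)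
      = opj₂ ω X Y (Unitary.conjStarAlgAut ℂ _ (Y.U t) y) := by
  have h : (unitaryTensor (X.U t) (Y.U t) : HTensor X.H Y.H →L[ℂ] HTensor X.H Y.H)
      * opj₂ ω X Y y = opj₂ ω X Y (Unitary.conjStarAlgAut ℂ _ (Y.U t) y)
        * (unitaryTensor (X.U t) (Y.U t) : HTensor X.H Y.H →L[ℂ] HTensor X.H Y.H) := by
    change opTensor _ _ ∘L (dualBraid ω X Y ∘L opTensor y 1 ∘L braid ω X Y)
      = (dualBraid ω X Y ∘L opTensor _ 1 ∘L braid ω X Y) ∘L opTensor _ _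
    rw [← ContinuousLinearMap.comp_assoc, dualBraid_comm, ContinuousLinearMap.comp_assoc,
      ContinuousLinearMap.comp_assoc, ContinuousLinearMap.comp_assoc, ← braid_comm,
      ← ContinuousLinearMap.comp_assoc (opTensor _ _) (opTensor y 1),
      ← ContinuousLinearMap.comp_assoc (opTensor _ 1) (opTensor _ _), opTensor_comp,
      opTensor_comp, Unitary.conjStarAlgAut_apply]
    congr 3
    simp only [← ContinuousLinearMap.mul_def, mul_assoc, Unitary.star_mul_self_of_mem (Y.U t).2,
      mul_one]
  rw [Unitary.conjStarAlgAut_apply, h, mul_assoc,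
    Unitary.mul_star_self_of_mem (unitaryTensor (X.U t) (Y.U t)).2, mul_one]

/-- The `C*`-algebra of operators underlying the braided tensor product, generated by the products
`j₁(x) j₂(y)`; equivalently, as `X` and `Y` are unital, by all `j₁(x)` and `j₂(y)`. -/
def boxAlg (X : ZNAlg.{u} N) (Y : ZNAlg.{v} N) :
    StarSubalgebra ℂ (HTensor X.H Y.H →L[ℂ] HTensor X.H Y.H) :=
  (StarAlgebra.adjoin ℂ (boxGens ω X Y)).topologicalClosure

theorem opj₁_mem (X : ZNAlg.{u} N) (Y : ZNAlg.{v} N) {x : X.H →L[ℂ] X.H} (hx : x ∈ X.A) :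
    opj₁ X Y x ∈ boxAlg ω X Y :=
  StarSubalgebra.le_topologicalClosure _ (StarAlgebra.subset_adjoin ℂ _ (Or.inl ⟨x, hx, rfl⟩))

theorem opj₂_mem (X : ZNAlg.{u} N) (Y : ZNAlg.{v} N) {y : Y.H →L[ℂ] Y.H} (hy : y ∈ Y.A) :
    opj₂ ω X Y y ∈ boxAlg ω X Y :=
  StarSubalgebra.le_topologicalClosure _ (StarAlgebra.subset_adjoin ℂ _ (Or.inr ⟨y, hy, rfl⟩))

theorem boxAlg_conj_mem (X : ZNAlg.{u} N) (Y : ZNAlg.{v} N) (t : Multiplicative (ZMod N))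
    (a : HTensor X.H Y.H →L[ℂ] HTensor X.H Y.H) (ha : a ∈ boxAlg ω X Y) :
    Unitary.conjStarAlgAut ℂ _ (unitaryTensor (X.U t) (Y.U t)) a ∈ boxAlg ω X Y := by
  refine conj_mem_closure (boxGens ω X Y) _ ?_ a ha
  rintro _ (⟨x, hx, rfl⟩ | ⟨y, hy, rfl⟩)
  · rw [conj_opj₁]
    exact opj₁_mem ω X Y (X.conj_mem t x hx)
  · rw [conj_opj₂]
    exact opj₂_mem ω X Y (Y.conj_mem t y hy)

/-- The tensor product of the unitary representations of `ℤ/N`. -/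
def boxU (X : ZNAlg.{u} N) (Y : ZNAlg.{v} N) :
    Multiplicative (ZMod N) →* unitary (HTensor X.H Y.H →L[ℂ] HTensor X.H Y.H) where
  toFun t := unitaryTensor (X.U t) (Y.U t)
  map_one' := by
    rw [map_one, map_one]
    exact Subtype.ext opTensor_one
  map_mul' s t := by
    rw [map_mul, map_mul]
    exact Subtype.ext (opTensor_mul _ _ _ _).symm

/-- The braided tensor product `X ⊠ Y`: the `C*`-algebra generated by the products `j₁(x) j₂(y)`,
with the action given by the tensor product of the unitary representations, for which `j₁` and
`j₂` are equivariant. -/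
def box (X : ZNAlg.{u} N) (Y : ZNAlg.{v} N) : ZNAlg.{max u v} N where
  H := HTensor X.H Y.H
  U := boxU X Y
  A := boxAlg ω X Y
  isClosed := StarSubalgebra.isClosed_topologicalClosure _
  conj_mem := boxAlg_conj_mem ω X Y

/-- The canonical embedding `j₁ : X → X ⊠ Y`. -/
def j₁ (X : ZNAlg.{u} N) (Y : ZNAlg.{v} N) (x : X.A) : (box ω X Y).A :=
  ⟨opj₁ X Y x, opj₁_mem ω X Y x.2⟩

/-- The canonical embedding `j₂ : Y → X ⊠ Y`. -/
def j₂ (X : ZNAlg.{u} N) (Y : ZNAlg.{v} N) (y : Y.A) : (box ω X Y).A :=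
  ⟨opj₂ ω X Y y, opj₂_mem ω X Y y.2⟩

end ZNAlg

/-! ### The `ℤ/N`-`C*`-algebras `C(ℤ/N)` and `C(S_N⁺(R))` -/

section CZ

variable (N : ℕ) [NeZero N]

/-- The representation of `C(ℤ/N)` on `ℓ²(ℤ/N)` by pointwise multiplication. -/
def mulOp : (ZMod N → ℂ) →⋆ₐ[ℂ]
    (EuclideanSpace ℂ (ZMod N) →L[ℂ] EuclideanSpace ℂ (ZMod N)) where
  toFun f := Matrix.toEuclideanCLM (𝕜 := ℂ) (Matrix.diagonal f)
  map_one' := by rw [Matrix.diagonal_one', map_one]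
  map_mul' f g := by
    rw [← map_mul, Matrix.diagonal_mul_diagonal]
    rfl
  map_zero' := by rw [Matrix.diagonal_zero', map_zero]
  map_add' f g := by
    rw [← map_add, Matrix.diagonal_add]
    rfl
  commutes' r := by
    rw [← AlgHomClass.commutes (Matrix.toEuclideanCLM (n := ZMod N) (𝕜 := ℂ)) r]
    rfl
  map_star' f := by rw [← map_star, Matrix.star_eq_conjTranspose, Matrix.diagonal_conjTranspose]

theorem mulOp_apply (f : ZMod N → ℂ) (ξ : EuclideanSpace ℂ (ZMod N)) (s : ZMod N) :
    mulOp N f ξ s = f s * ξ s := by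
  change (Matrix.diagonal f).mulVec ξ s = _
  rw [Matrix.mulVec_diagonal]

/-- The regular representation `(U t ξ)(s) = ξ(s + t)` of `ℤ/N` on `ℓ²(ℤ/N)`. -/
def regU : Multiplicative (ZMod N) →*
    unitary (EuclideanSpace ℂ (ZMod N) →L[ℂ] EuclideanSpace ℂ (ZMod N)) :=
  (Unitary.linearIsometryEquiv (𝕜 := ℂ)
    (H := EuclideanSpace ℂ (ZMod N))).symm.toMonoidHom.comp
    { toFun := fun t => LinearIsometryEquiv.piLpCongrLeft 2 ℂ ℂ (Equiv.subRight t.toAdd)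
      map_one' := by
        ext ξ s
        simp [LinearIsometryEquiv.piLpCongrLeft_apply]
      map_mul' := fun t t' => by
        ext ξ s
        simp [LinearIsometryEquiv.piLpCongrLeft_apply, add_assoc] }

theorem regU_apply (t : Multiplicative (ZMod N)) (ξ : EuclideanSpace ℂ (ZMod N)) (s : ZMod N) :
    (regU N t : EuclideanSpace ℂ (ZMod N) →L[ℂ] EuclideanSpace ℂ (ZMod N)) ξ s
      = ξ (s + t.toAdd) := rfl

theorem regU_conj (t : Multiplicative (ZMod N)) (f : ZMod N → ℂ) :
    Unitary.conjStarAlgAut ℂ _ (regU N t) (mulOp N f) = mulOp N (fun s => f (s + t.toAdd)) := by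
  have h : (regU N t : EuclideanSpace ℂ (ZMod N) →L[ℂ] EuclideanSpace ℂ (ZMod N)) * mulOp N f
      = mulOp N (fun s => f (s + t.toAdd)) * regU N t := by
    refine ContinuousLinearMap.ext fun ξ => PiLp.ext fun s => ?_
    rw [mul_apply_eq_comp, mul_apply_eq_comp, regU_apply, mulOp_apply,
      mulOp_apply, regU_apply]
  rw [Unitary.conjStarAlgAut_apply, h, mul_assoc, Unitary.mul_star_self_of_mem (regU N t).2,
    mul_one]

/-- The `ℤ/N`-`C*`-algebra `C(ℤ/N)`, acting on `ℓ²(ℤ/N)` by pointwise multiplication, with the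
action by translations `ρ_t(f)(s) = f(s + t)`, i.e. the coaction given by the comultiplication. -/
def CZ : ZNAlg.{0} N where
  H := EuclideanSpace ℂ (ZMod N)
  U := regU N
  A := (mulOp N).range
  isClosed := Submodule.closed_of_finiteDimensional
    (mulOp N).range.toSubalgebra.toSubmodule
  conj_mem := by
    rintro t _ ⟨f, rfl⟩
    exact ⟨_, (regU_conj N t f).symm⟩

/-- A function on `ℤ/N` as an element of `C(ℤ/N)`. -/
def CZ.ofFun (f : ZMod N → ℂ) : (CZ N).A := ⟨mulOp N f, ⟨f, rfl⟩⟩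

/-- The function `δ_t` on `ℤ/N`. -/
def CZ.delta (t : ZMod N) : (CZ N).A := CZ.ofFun N (fun s => if s = t then 1 else 0)

/-- The unitary generator `z` of `C(ℤ/N)`: the function `t ↦ ω ^ t`. -/
def CZ.z (ω : ℂ) : (CZ N).A := CZ.ofFun N (zpw ω)

end CZ

/-- A faithful `ℤ/N`-equivariant representation of `C(S_N⁺(R))` on a Hilbert space, where
`C(S_N⁺(R))` carries the action determined by `ρ_t(q i j) = ω ^ (t * (j - i)) q i j`. -/
structure EquivariantRep (N : ℕ) [NeZero N] (ω : ℂ) where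
  H : Type u
  [normedAddCommGroup : NormedAddCommGroup H]
  [innerProductSpace : InnerProductSpace ℂ H]
  [completeSpace : CompleteSpace H]
  U : Multiplicative (ZMod N) →* unitary (H →L[ℂ] H)
  π : CS N ω →⋆ₐ[ℂ] (H →L[ℂ] H)
  injective : Function.Injective π
  equivariant : ∀ t i j : ZMod N,
    Unitary.conjStarAlgAut ℂ (H →L[ℂ] H) (U (Multiplicative.ofAdd t)) (π (q ω i j))
      = zpw ω (t * (j - i)) • π (q ω i j)

attribute [instance] EquivariantRep.normedAddCommGroup EquivariantRep.innerProductSpace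
  EquivariantRep.completeSpace

namespace EquivariantRep

variable {N : ℕ} [NeZero N] {ω : ℂ} (L : EquivariantRep.{u} N ω)

theorem isClosed_range : IsClosed (L.π.range : Set (L.H →L[ℂ] L.H)) := by
  have h := (NonUnitalStarAlgHom.isometry L.π L.injective).isClosedEmbedding.isClosed_range
  have h' : (L.π.range : Set (L.H →L[ℂ] L.H)) = Set.range L.π := rfl
  rwa [h']

theorem conj_mem_range (t : Multiplicative (ZMod N)) (a : L.H →L[ℂ] L.H) (ha : a ∈ L.π.range) :
    Unitary.conjStarAlgAut ℂ (L.H →L[ℂ] L.H) (L.U t) a ∈ L.π.range := by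
  obtain ⟨a, rfl⟩ := ha
  let φ : CS N ω →⋆ₐ[ℂ] (L.H →L[ℂ] L.H) :=
    (Unitary.conjStarAlgAut ℂ (L.H →L[ℂ] L.H) (L.U t) :
      (L.H →L[ℂ] L.H) →⋆ₐ[ℂ] (L.H →L[ℂ] L.H)).comp L.π
  have hφ : Continuous φ := by
    have := (NonUnitalStarAlgHom.isometry L.π L.injective).continuous
    change Continuous fun a => (L.U t : L.H →L[ℂ] L.H) * L.π a *
      ((star (L.U t) : unitary (L.H →L[ℂ] L.H)) : L.H →L[ℂ] L.H)
    fun_prop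
  refine CS.induction (L.π.range.comap φ) (L.isClosed_range.preimage hφ) (fun i j => ?_) a
  refine ⟨zpw ω (t.toAdd * (j - i)) • q ω i j, ?_⟩
  have h := L.equivariant t.toAdd i j
  exact (map_smul L.π _ _).trans h.symm

/-- `C(S_N⁺(R))` as a `ℤ/N`-`C*`-algebra of operators. -/
def alg : ZNAlg.{u} N where
  H := L.H
  U := L.U
  A := L.π.range
  isClosed := L.isClosed_range
  conj_mem := L.conj_mem_range

/-- An element of `C(S_N⁺(R))` as an operator. -/
def op (a : CS N ω) : L.alg.A := ⟨L.π a, ⟨a, rfl⟩⟩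

/-! ### The bosonization -/

/-- `C(S_N⁺(R)) ⊠ C(S_N⁺(R))`. -/
abbrev double : ZNAlg.{u} N := ZNAlg.box ω L.alg L.alg

/-- `C(S_N⁺(R) ⋊ ℤ/N) = C(ℤ/N) ⊠ C(S_N⁺(R))`. -/
abbrev boson : ZNAlg.{u} N := ZNAlg.box ω (CZ N) L.alg

/-- `C(ℤ/N) ⊠ C(S_N⁺(R)) ⊠ C(S_N⁺(R))`. -/
abbrev triple : ZNAlg.{u} N := ZNAlg.box ω (CZ N) L.double

/-- The comultiplication of `S_N⁺(R)`: the unital `*`-homomorphism with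
`Δ(q i j) = ∑ k, j₁(q i k) j₂(q k j)`. -/
def IsBraidedComult (Δ : CS N ω →⋆ₐ[ℂ] L.double.A) : Prop :=
  ∀ i j, Δ (q ω i j)
    = ∑ k, ZNAlg.j₁ ω L.alg L.alg (L.op (q ω i k)) * ZNAlg.j₂ ω L.alg L.alg (L.op (q ω k j))

/-- `Φ = id ⊠ Δ`: the unital `*`-homomorphism with `Φ(j₁(x) j₂(a)) = j₁(x) j₂(Δ(a))`. -/
def IsIdBoxComult (Δ : CS N ω →⋆ₐ[ℂ] L.double.A) (Φ : L.boson.A →⋆ₐ[ℂ] L.triple.A) : Prop :=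
  ∀ (x : (CZ N).A) (a : CS N ω),
    Φ (ZNAlg.j₁ ω (CZ N) L.alg x * ZNAlg.j₂ ω (CZ N) L.alg (L.op a))
      = ZNAlg.j₁ ω (CZ N) L.double x * ZNAlg.j₂ ω (CZ N) L.double (Δ a)

/-- The unital `*`-homomorphism
`ψ : C(ℤ/N) ⊠ X ⊠ X → (C(ℤ/N) ⊠ X) ⊗ (C(ℤ/N) ⊠ X)`, `X = C(S_N⁺(R))`, with
`ψ(j₁(x)) = (j₁ ⊗ j₁)(Δ(x))`, `ψ(j₂(a)) = (j₂ ⊗ j₁)(ρ(a))` and `ψ(j₃(b)) = 1 ⊗ j₂(b)`, where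
`Δ(f) = ∑ s t, f(s + t) δ_s ⊗ δ_t` in `C(ℤ/N) ⊗ C(ℤ/N)` and
`ρ(a) = ∑ t, ρ_t(a) ⊗ δ_t` in `X ⊗ C(ℤ/N)`. -/
structure IsPsi (ψ : L.triple.A →⋆ₐ[ℂ] minTensor L.boson.A L.boson.A) : Prop where
  first : ∀ f : ZMod N → ℂ, ψ (ZNAlg.j₁ ω (CZ N) L.double (CZ.ofFun N f))
    = ∑ s, ∑ t, f (s + t) • minTensor.tmul (ZNAlg.j₁ ω (CZ N) L.alg (CZ.delta N s))
        (ZNAlg.j₁ ω (CZ N) L.alg (CZ.delta N t))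
  second : ∀ a : L.alg.A, ψ (ZNAlg.j₂ ω (CZ N) L.double (ZNAlg.j₁ ω L.alg L.alg a))
    = ∑ t, minTensor.tmul (ZNAlg.j₂ ω (CZ N) L.alg (L.alg.act t a))
        (ZNAlg.j₁ ω (CZ N) L.alg (CZ.delta N t))
  third : ∀ b : L.alg.A, ψ (ZNAlg.j₂ ω (CZ N) L.double (ZNAlg.j₂ ω L.alg L.alg b))
    = minTensor.tmul 1 (ZNAlg.j₂ ω (CZ N) L.alg b)

/-- The comultiplication `ψ ∘ (id ⊠ Δ)` of the bosonization `S_N⁺(R) ⋊ ℤ/N`. -/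
def IsBosonComult (D : L.boson.A →⋆ₐ[ℂ] minTensor L.boson.A L.boson.A) : Prop :=
  ∃ (Δ : CS N ω →⋆ₐ[ℂ] L.double.A) (Φ : L.boson.A →⋆ₐ[ℂ] L.triple.A)
    (ψ : L.triple.A →⋆ₐ[ℂ] minTensor L.boson.A L.boson.A),
    L.IsBraidedComult Δ ∧ L.IsIdBoxComult Δ Φ ∧ L.IsPsi ψ ∧ D = ψ.comp Φ

/-- The unitary `j₁(z)`. -/
def z : L.boson.A := ZNAlg.j₁ ω (CZ N) L.alg (CZ.z N ω)

/-- The matrix `t i j = j₁(z ^ i) j₂(q i j)`. -/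
def t : Matrix (ZMod N) (ZMod N) L.boson.A := fun i j =>
  ZNAlg.j₁ ω (CZ N) L.alg (CZ.z N ω ^ i.val) * ZNAlg.j₂ ω (CZ N) L.alg (L.op (q ω i j))

/-- The direct sum `z ⊕ t`. -/
def zt : Matrix (Unit ⊕ ZMod N) (Unit ⊕ ZMod N) L.boson.A :=
  Matrix.fromBlocks (fun _ _ => L.z) 0 0 L.t

end EquivariantRep

/-! ### Compact matrix quantum groups -/

section CMQG

variable {H : Type*} [NormedAddCommGroup H] [InnerProductSpace ℂ H] [CompleteSpace H]
  {n : Type*} [Fintype n] [DecidableEq n]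

/-- `u` is a finite-dimensional representation matrix for the comultiplication `D`:
`D(u i j) = ∑ k, u i k ⊗ u k j`. -/
def IsRepMatrix {A : StarSubalgebra ℂ (H →L[ℂ] H)} (D : A →⋆ₐ[ℂ] minTensor A A)
    (u : Matrix n n A) : Prop :=
  ∀ i j, D (u i j) = ∑ k, minTensor.tmul (u i k) (u k j)

/-- `u` is a finite-dimensional unitary representation for the comultiplication `D`. -/
def IsUnitaryRep {A : StarSubalgebra ℂ (H →L[ℂ] H)} (D : A →⋆ₐ[ℂ] minTensor A A)
    (u : Matrix n n A) : Prop :=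
  u ∈ unitary (Matrix n n A) ∧ IsRepMatrix D u

/-- The pair `(A, u)` is a compact matrix quantum group with comultiplication `D`: `A` is a unital
`C*`-algebra, the entries of the matrix `u` generate a dense `*`-subalgebra of `A`, the unital
`*`-homomorphism `D : A → A ⊗ A` satisfies `D(u i j) = ∑ k, u i k ⊗ u k j`, and the matrices `u`
and `ū = (u i j)*` are invertible. -/
structure IsCompactMatrixQuantumGroup (A : StarSubalgebra ℂ (H →L[ℂ] H))
    (D : A →⋆ₐ[ℂ] minTensor A A) (u : Matrix n n A) : Prop where
  isClosed : IsClosed (A : Set (H →L[ℂ] H))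
  dense : Dense (StarAlgebra.adjoin ℂ {a : A | ∃ i j, a = u i j} : Set A)
  rep : IsRepMatrix D u
  isUnit : IsUnit u
  isUnit_conj : IsUnit (u.map star)

end CMQG

end

/-!
The elements `∑ k, j₁ (q i k) * j₂ (q k j)` of `X ⊠ X` again satisfy the relations of the `q i j`,
so `Δ` exists by universality. The homomorphisms `id ⊠ Δ` and `ψ` have to be defined on concrete
operator algebras. An orthonormal basis of `ℓ²(ℤ/N)` consisting of characters decomposes
`ℓ²(ℤ/N) ⊗ H` into copies of `H`, and `C(ℤ/N) ⊠ X` then acts by matrices over `X`, where `z` is a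
permutation matrix and `j₂ a` is the diagonal matrix with entries `ρ_{-m}(a)`; applying an
equivariant homomorphism to the entries gives `id ⊠ Δ`. The homomorphism `ψ` is
`x ⊗ a ⊗ b ↦ (x ⊗ a) ⊗ j₂ b`, conjugated by the unitary that acts on the second leg as `z ^ n` over
the part of weight `n` of the first leg.

On generators `Δ_⋊` is then forced to be `z ↦ z ⊗ z` and `q i j ↦ ∑ k, q i k ⊗ z ^ (k - i) q k j`,
which gives uniqueness and, for `t i j = z ^ i q i j`, the formula `t i j ↦ ∑ k, t i k ⊗ t k j`.
The commutation rule between `z` and `q i j` gives `star (t i j) = t (-i) (-j)`, so that the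
conjugate of `t` is unitary together with `t`.
-/

noncomputable section

/-! ### Roots of unity -/

section RootsOfUnity

variable {N : ℕ} {ω : ℂ}

theorem zpw_zero : zpw ω (0 : ZMod N) = 1 := by simp [zpw]

variable [NeZero N]

theorem zpw_eq_zmodChar (h : ω ^ N = 1) (a : ZMod N) : zpw ω a = AddChar.zmodChar N h a := rfl

theorem zpw_add (hω : IsPrimitiveRoot ω N) (a b : ZMod N) :
    zpw ω (a + b) = zpw ω a * zpw ω b := by
  simp only [zpw_eq_zmodChar hω.pow_eq_one, AddChar.map_add_eq_mul]

theorem zpw_neg_mul_self (hω : IsPrimitiveRoot ω N) (a : ZMod N) :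
    zpw ω (-a) * zpw ω a = 1 := by
  rw [← zpw_add hω, neg_add_cancel, zpw_zero]

theorem star_zpw (hω : IsPrimitiveRoot ω N) (a : ZMod N) : star (zpw ω a) = zpw ω (-a) := by
  have hnorm : ‖zpw ω a‖ = 1 := by
    rw [zpw, norm_pow, hω.norm'_eq_one (NeZero.ne N), one_pow]
  have hmul : star (zpw ω a) * zpw ω a = 1 := by
    have := Complex.conj_mul' (zpw ω a)
    rw [hnorm] at this
    simpa using this
  have hne : zpw ω a ≠ 0 := fun h => by simp [h] at hnorm
  exact mul_right_cancel₀ hne (hmul.trans (zpw_neg_mul_self hω a).symm)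

theorem sum_zpw_mul_right (hω : IsPrimitiveRoot ω N) (b : ZMod N) :
    ∑ a : ZMod N, zpw ω (a * b) = if b = 0 then (N : ℂ) else 0 := by
  have := AddChar.sum_mulShift b (AddChar.zmodChar_primitive_of_primitive_root N hω)
  simp only [ZMod.card] at this
  exact_mod_cast this

theorem sum_zpw_mul_left (hω : IsPrimitiveRoot ω N) (b : ZMod N) :
    ∑ a : ZMod N, zpw ω (b * a) = if b = 0 then (N : ℂ) else 0 := by
  simp only [mul_comm b, sum_zpw_mul_right hω]

end RootsOfUnity

/-! ### `*`-homomorphisms of concrete `C*`-algebras -/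

section StarHom

theorem continuous_starAlgHom {A B : Type*} [CStarAlgebra A] [CStarAlgebra B]
    (φ : A →⋆ₐ[ℂ] B) : Continuous φ :=
  AddMonoidHomClass.continuous_of_bound φ 1 fun a => by
    simpa using NonUnitalStarAlgHom.norm_apply_le φ a

theorem continuous_starAlgHom_of_isClosed {A B : Type*} [CStarAlgebra A] [CStarAlgebra B]
    {S : StarSubalgebra ℂ A} (hS : IsClosed (S : Set A)) (φ : S →⋆ₐ[ℂ] B) : Continuous φ := by
  have : IsClosed (S : Set A) := hS
  exact continuous_starAlgHom φ

theorem continuous_starAlgHom_restrict {A B : Type*} [CStarAlgebra A] [CStarAlgebra B]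
    {S : StarSubalgebra ℂ A} (hS : IsClosed (S : Set A)) {T : StarSubalgebra ℂ B}
    (φ : S →⋆ₐ[ℂ] T) : Continuous φ :=
  continuous_induced_rng.mpr (continuous_starAlgHom_of_isClosed hS (T.subtype.comp φ))

theorem starAlgHom_mem_of_generators {A B : Type*} [CStarAlgebra A] [CStarAlgebra B] {s : Set A}
    {C : StarSubalgebra ℂ B} (hC : IsClosed (C : Set B))
    (φ : (StarAlgebra.adjoin ℂ s).topologicalClosure →⋆ₐ[ℂ] B)
    (h : ∀ a : (StarAlgebra.adjoin ℂ s).topologicalClosure, (a : A) ∈ s → φ a ∈ C)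
    (x : (StarAlgebra.adjoin ℂ s).topologicalClosure) : φ x ∈ C := by
  have hcl := StarSubalgebra.isClosed_topologicalClosure (StarAlgebra.adjoin ℂ s)
  have hφ := continuous_starAlgHom_of_isClosed hcl φ
  have hle : (StarAlgebra.adjoin ℂ s).topologicalClosure ≤
      (C.comap φ).map (StarSubalgebra.subtype _) := by
    refine StarSubalgebra.topologicalClosure_minimal (StarAlgebra.adjoin_le fun a ha => ?_) ?_
    · exact ⟨⟨a, StarSubalgebra.le_topologicalClosure _ (StarAlgebra.subset_adjoin ℂ s ha)⟩,
        h _ ha, rfl⟩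
    · exact hcl.isClosedEmbedding_subtypeVal.isClosedMap _ (hC.preimage hφ)
  obtain ⟨y, hy, hyx⟩ := hle x.2
  obtain rfl : y = x := Subtype.ext hyx
  exact hy

end StarHom

/-! ### Operators on tensor products of Hilbert spaces -/

section OpTensor

open ContinuousLinearMap (adjoint)

variable {H H' : Type*} {K K' : Type*}
  [NormedAddCommGroup H] [InnerProductSpace ℂ H]
  [NormedAddCommGroup H'] [InnerProductSpace ℂ H']
  [NormedAddCommGroup K] [InnerProductSpace ℂ K]
  [NormedAddCommGroup K'] [InnerProductSpace ℂ K']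

theorem HTensor.add_tmul (x x' : H) (y : K) :
    HTensor.tmul (x + x') y = HTensor.tmul x y + HTensor.tmul x' y := by
  simp only [HTensor.tmul, TensorProduct.add_tmul, map_add]

theorem HTensor.tmul_add (x : H) (y y' : K) :
    HTensor.tmul x (y + y') = HTensor.tmul x y + HTensor.tmul x y' := by
  simp only [HTensor.tmul, TensorProduct.tmul_add, map_add]

theorem HTensor.sum_tmul {ι : Type*} (s : Finset ι) (x : ι → H) (y : K) :
    HTensor.tmul (∑ i ∈ s, x i) y = ∑ i ∈ s, HTensor.tmul (x i) y := by
  simp only [HTensor.tmul, TensorProduct.sum_tmul, map_sum]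

theorem HTensor.smul_tmul (r : ℂ) (x : H) (y : K) :
    HTensor.tmul (r • x) y = r • HTensor.tmul x y := by
  rw [HTensor.tmul, HTensor.tmul, ← map_smul, TensorProduct.smul_tmul']

theorem HTensor.tmul_smul (r : ℂ) (x : H) (y : K) :
    HTensor.tmul x (r • y) = r • HTensor.tmul x y := by
  simp only [HTensor.tmul, TensorProduct.tmul_smul, map_smul]

theorem HTensor.norm_tmul (x : H) (y : K) : ‖HTensor.tmul x y‖ = ‖x‖ * ‖y‖ := by
  rw [HTensor.tmul, LinearIsometry.norm_map, TensorProduct.norm_tmul]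

/-- The tensor product of operators as a bilinear map, which makes the linearity lemmas of
`LinearMap` available for `opTensor`. -/
def opTensorₗ (H H' K K' : Type*) [NormedAddCommGroup H] [InnerProductSpace ℂ H]
    [NormedAddCommGroup H'] [InnerProductSpace ℂ H'] [NormedAddCommGroup K]
    [InnerProductSpace ℂ K] [NormedAddCommGroup K'] [InnerProductSpace ℂ K'] :
    (H →L[ℂ] H') →ₗ[ℂ] (K →L[ℂ] K') →ₗ[ℂ] (HTensor H K →L[ℂ] HTensor H' K') :=
  LinearMap.mk₂ ℂ opTensor
    (fun a a' b => HTensor.ext fun x y => by simp [HTensor.add_tmul])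
    (fun r a b => HTensor.ext fun x y => by simp [HTensor.smul_tmul])
    (fun a b b' => HTensor.ext fun x y => by simp [HTensor.tmul_add])
    (fun r a b => HTensor.ext fun x y => by simp [HTensor.tmul_smul])

theorem opTensor_eq (a : H →L[ℂ] H') (b : K →L[ℂ] K') :
    opTensor a b = opTensorₗ H H' K K' a b := rfl

theorem opTensor_add_left (a a' : H →L[ℂ] H') (b : K →L[ℂ] K') :
    opTensor (a + a') b = opTensor a b + opTensor a' b := by simp [opTensor_eq]

theorem opTensor_add_right (a : H →L[ℂ] H') (b b' : K →L[ℂ] K') :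
    opTensor a (b + b') = opTensor a b + opTensor a b' := by simp [opTensor_eq]

theorem opTensor_smul_left (r : ℂ) (a : H →L[ℂ] H') (b : K →L[ℂ] K') :
    opTensor (r • a) b = r • opTensor a b := by simp [opTensor_eq]

theorem opTensor_smul_right (r : ℂ) (a : H →L[ℂ] H') (b : K →L[ℂ] K') :
    opTensor a (r • b) = r • opTensor a b := by simp [opTensor_eq]

theorem opTensor_zero_left (b : K →L[ℂ] K') : opTensor (0 : H →L[ℂ] H') b = 0 := by
  simp [opTensor_eq]

theorem opTensor_zero_right (a : H →L[ℂ] H') : opTensor a (0 : K →L[ℂ] K') = 0 := by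
  simp [opTensor_eq]

theorem opTensor_sum_left {ι : Type*} (s : Finset ι) (a : ι → H →L[ℂ] H') (b : K →L[ℂ] K') :
    opTensor (∑ i ∈ s, a i) b = ∑ i ∈ s, opTensor (a i) b := by simp [opTensor_eq]

theorem opTensor_sum_right {ι : Type*} (s : Finset ι) (a : H →L[ℂ] H') (b : ι → K →L[ℂ] K') :
    opTensor a (∑ i ∈ s, b i) = ∑ i ∈ s, opTensor a (b i) := by simp [opTensor_eq]

theorem flipOp_comp_flipOp : flipOp K H ∘L flipOp H K = 1 :=
  HTensor.ext fun x y => by simp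

theorem flipOp_opTensor_flipOp (a : H →L[ℂ] H') (b : K →L[ℂ] K') :
    flipOp H' K' ∘L opTensor a b ∘L flipOp K H = opTensor b a := by
  rw [← ContinuousLinearMap.comp_assoc, opTensor_flipOp, ContinuousLinearMap.comp_assoc,
    flipOp_comp_flipOp]
  rfl

theorem adjoint_opTensor [CompleteSpace H] [CompleteSpace H'] [CompleteSpace K] [CompleteSpace K']
    (a : H →L[ℂ] H') (b : K →L[ℂ] K') :
    adjoint (opTensor a b) = opTensor (adjoint a) (adjoint b) := by
  symm
  rw [ContinuousLinearMap.eq_adjoint_iff]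
  intro v w
  induction v using HTensor.induction with
  | closed => exact isClosed_eq (by fun_prop) (by fun_prop)
  | zero => simp
  | add v v' hv hv' => rw [map_add, inner_add_left, inner_add_left, hv, hv']
  | tmul x y =>
    induction w using HTensor.induction with
    | closed => exact isClosed_eq (by fun_prop) (by fun_prop)
    | zero => simp
    | add w w' hw hw' => rw [map_add, inner_add_right, inner_add_right, hw, hw']
    | tmul x' y' => simp [ContinuousLinearMap.adjoint_inner_left, HTensor.inner_tmul]

/-- The operator `η ↦ x ⊗ η`; the operators `ket K (b i)` of an orthonormal basis `b` embed `K` as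
the mutually orthogonal slices of `H ⊗ K`. -/
def ket (K : Type*) [NormedAddCommGroup K] [InnerProductSpace ℂ K] (x : H) :
    K →L[ℂ] HTensor H K :=
  LinearMap.mkContinuous
    { toFun := fun y => HTensor.tmul x y
      map_add' := HTensor.tmul_add x
      map_smul' := fun r y => HTensor.tmul_smul r x y } ‖x‖
    fun y => (HTensor.norm_tmul x y).le

@[simp] theorem ket_apply (x : H) (y : K) : ket K x y = HTensor.tmul x y := rfl

theorem adjoint_ket_tmul [CompleteSpace K] (x x' : H) (y : K) :
    adjoint (ket K x) (HTensor.tmul x' y) = inner ℂ x x' • y := by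
  refine ext_inner_left ℂ fun v => ?_
  rw [ContinuousLinearMap.adjoint_inner_right, ket_apply, HTensor.inner_tmul, inner_smul_right]

theorem adjoint_ket_comp_ket [CompleteSpace K] (x x' : H) :
    adjoint (ket K x) ∘L ket K x' = inner ℂ x x' • 1 :=
  ContinuousLinearMap.ext fun y => by simp [adjoint_ket_tmul]

theorem sum_ket_comp_adjoint_ket [CompleteSpace K] {ι : Type*} [Fintype ι]
    (b : OrthonormalBasis ι ℂ H) :
    ∑ i, ket K (b i) ∘L adjoint (ket K (b i)) = 1 := by
  refine HTensor.ext fun x y => ?_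
  rw [one_apply_eq_self]
  conv_rhs => rw [← b.sum_repr' x, HTensor.sum_tmul]
  simp [adjoint_ket_tmul, HTensor.smul_tmul]

end OpTensor

/-! ### Universal properties -/

section Universal

/-- The universal property of a free `*`-algebra: the unital `*`-homomorphism with given values on
the generators. -/
def FreeStarAlg.lift {G : Type} {B : Type*} [Ring B] [StarRing B] [Algebra ℂ B] [StarModule ℂ B]
    (b : G → B) : FreeStarAlg G →⋆ₐ[ℂ] B :=
  let φ : FreeStarAlg G →ₐ[ℂ] B :=
    FreeAlgebra.lift ℂ (fun x : G ⊕ G => Sum.elim b (fun g => star (b g)) x)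
  have hφ : ∀ x : G ⊕ G, φ (FreeStarAlg.letter x) = Sum.elim b (fun g => star (b g)) x :=
    fun x => FreeAlgebra.lift_ι_apply (R := ℂ) _ x
  { φ with
    map_star' := fun a => by
      change φ (star a) = star (φ a)
      induction a using FreeStarAlg.induction with
      | scalar r => rw [FreeStarAlg.star_algebraMap', AlgHom.commutes, AlgHom.commutes,
          algebraMap_star_comm]
      | letter x => rw [FreeStarAlg.star_letter, hφ, hφ]; cases x <;> simp
      | mul a b ha hb => rw [star_mul, map_mul, map_mul, star_mul, ha, hb]
      | add a b ha hb => rw [star_add, map_add, map_add, star_add, ha, hb] }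

theorem FreeStarAlg.lift_gen {G : Type} {B : Type*} [Ring B] [StarRing B] [Algebra ℂ B]
    [StarModule ℂ B] (b : G → B) (g : G) : FreeStarAlg.lift b (FreeStarAlg.gen g) = b g :=
  FreeAlgebra.lift_ι_apply (R := ℂ) (fun x : G ⊕ G => Sum.elim b (fun g => star (b g)) x)
    (Sum.inl g)

/-- The `C*`-seminorm pulled back along a `*`-homomorphism into a `C*`-algebra, the source of
competitors for the maximal `C*`-seminorm. -/
def CStarSeminorm.ofHom {F : Type} [Ring F] [StarRing F] [Algebra ℂ F] {B : Type*}
    [CStarAlgebra B] (φ : F →⋆ₐ[ℂ] B) : CStarSeminorm F where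
  toSeminorm := (normSeminorm ℂ B).comp (φ.toAlgHom.toLinearMap)
  mul_le' a b := by
    change ‖φ (a * b)‖ ≤ ‖φ a‖ * ‖φ b‖
    rw [map_mul]
    exact norm_mul_le _ _
  star_mul_self' a := by
    change ‖φ (star a * a)‖ = ‖φ a‖ * ‖φ a‖
    rw [map_mul, StarHomClass.map_star, CStarRing.norm_star_mul_self]

theorem CStarSeminorm.exists_extension {F : Type} [Ring F] [StarRing F] [Algebra ℂ F]
    (p : CStarSeminorm F) {B : Type*} [CStarAlgebra B] (φ : F →⋆ₐ[ℂ] B)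
    (h : ∀ a, ‖φ a‖ ≤ p.toSeminorm a) :
    ∃ Φ : p.Compl →⋆ₐ[ℂ] B, ∀ a, Φ (p.toCompl a) = φ a := by
  let φ₀ : p.Space →+* B := (φ : F →+* B)
  have hφ₀ : Continuous φ₀ :=
    AddMonoidHomClass.continuous_of_bound φ₀ 1 fun a => by
      rw [one_mul]
      exact h a
  let Φ : p.Compl →+* B := UniformSpace.Completion.extensionHom φ₀ hφ₀
  have hΦ : ∀ a : F, Φ (p.toCompl a) = φ a := fun a =>
    UniformSpace.Completion.extensionHom_coe φ₀ hφ₀ a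
  have hc : Continuous Φ := UniformSpace.Completion.continuous_extension
  exact ⟨{ Φ with
    commutes' := fun r => by
      change Φ (p.toCompl (algebraMap ℂ F r)) = _
      rw [hΦ, AlgHomClass.commutes]
    map_star' := fun x => by
      change Φ (star x) = star (Φ x)
      induction x using p.induction_on with
      | hc => exact isClosed_eq (by fun_prop) (by fun_prop)
      | h a => rw [p.star_toCompl, hΦ, hΦ, StarHomClass.map_star] }, hΦ⟩

variable {N : ℕ} [NeZero N] {ω : ℂ}

/-- The defining relations of the anyonic quantum permutation group, for a family of elements of
a complex `*`-algebra; such families are the `*`-homomorphisms out of `CS N ω`. -/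
structure AnyonicFamily (ω : ℂ) {B : Type*} [Ring B] [StarRing B] [Algebra ℂ B]
    (b : ZMod N → ZMod N → B) : Prop where
  zero_left : ∀ i, b 0 i = if i = 0 then 1 else 0
  zero_right : ∀ i, b i 0 = if i = 0 then 1 else 0
  adj : ∀ i j, star (b i j) = zpw ω (-(i * (i - j))) • b (-i) (-j)
  right : ∀ i j k, b k (i + j) = ∑ l, zpw ω (-(l * (i - k + l))) • (b (k - l) i * b l j)
  left : ∀ i j k, b (i + j) k = ∑ l, zpw ω (-(i * (l - j))) • (b j l * b i (k - l))

theorem AnyonicFamily.exists_hom {B : Type*} [CStarAlgebra B] {b : ZMod N → ZMod N → B}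
    (hb : AnyonicFamily ω b) : ∃ φ : CS N ω →⋆ₐ[ℂ] B, ∀ i j, φ (q ω i j) = b i j := by
  let φ₀ : FreeQ N →⋆ₐ[ℂ] B := FreeStarAlg.lift fun g : ZMod N × ZMod N => b g.1 g.2
  have hφ₀ : ∀ i j, φ₀ (fq i j) = b i j := fun i j => FreeStarAlg.lift_gen _ (i, j)
  have hrel : ∀ x y, AnyonicRel N ω x y → φ₀ x = φ₀ y := by
    rintro _ _ (i | i | ⟨i, j⟩ | ⟨i, j, k⟩ | ⟨i, j, k⟩)
    · rw [hφ₀, hb.zero_left]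
      split_ifs <;> simp
    · rw [hφ₀, hb.zero_right]
      split_ifs <;> simp
    · rw [map_star, map_smul, hφ₀, hφ₀, hb.adj]
    · simp only [map_sum, map_smul, map_mul, hφ₀]
      exact hb.right i j k
    · simp only [map_sum, map_smul, map_mul, hφ₀]
      exact hb.left i j k
  let p : AnyonicSeminorm N ω := ⟨CStarSeminorm.ofHom φ₀, fun x y hxy => by
    change ‖φ₀ (x - y)‖ = 0
    rw [map_sub, hrel x y hxy, sub_self, norm_zero]⟩
  have hp : ∀ a, ‖φ₀ a‖ ≤ (maxSeminorm N ω).toSeminorm a := fun a =>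
    le_ciSup (AnyonicSeminorm.bddAbove (ω := ω) a) p
  obtain ⟨Φ, hΦ⟩ := (maxSeminorm N ω).exists_extension φ₀ hp
  exact ⟨Φ, fun i j => (hΦ (fq i j)).trans (hφ₀ i j)⟩

theorem toCompl_eq_of_anyonicRel {x y : FreeQ N} (h : AnyonicRel N ω x y) :
    (maxSeminorm N ω).toCompl x = (maxSeminorm N ω).toCompl y := by
  rw [← sub_eq_zero, ← CStarSeminorm.toCompl_sub, ← norm_eq_zero, CStarSeminorm.norm_toCompl]
  refine le_antisymm (ciSup_le fun p => (p.2 x y h).le) (apply_nonneg _ _)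

theorem anyonicFamily_q : AnyonicFamily ω (q (N := N) ω) := by
  have hsum := AnyonicSeminorm.toCompl_sum (maxSeminorm N ω)
  have hmul := (maxSeminorm N ω).toCompl_mul
  have hsmul := (maxSeminorm N ω).toCompl_smul
  refine ⟨fun i => ?_, fun i => ?_, fun i j => ?_, fun i j k => ?_, fun i j k => ?_⟩
  · refine (toCompl_eq_of_anyonicRel (AnyonicRel.zero_left i)).trans ?_
    split_ifs <;> rfl
  · refine (toCompl_eq_of_anyonicRel (AnyonicRel.zero_right i)).trans ?_
    split_ifs <;> rfl
  · refine ((maxSeminorm N ω).star_toCompl _).trans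
      ((toCompl_eq_of_anyonicRel (AnyonicRel.adj i j)).trans ?_)
    exact hsmul _ _
  · refine (toCompl_eq_of_anyonicRel (AnyonicRel.right i j k)).trans ?_
    simp only [hsum, hsmul, hmul]
    rfl
  · refine (toCompl_eq_of_anyonicRel (AnyonicRel.left i j k)).trans ?_
    simp only [hsum, hsmul, hmul]
    rfl

theorem AnyonicFamily.map {B C : Type*} [Ring B] [StarRing B] [Algebra ℂ B] [Ring C] [StarRing C]
    [Algebra ℂ C] {b : ZMod N → ZMod N → B} (hb : AnyonicFamily ω b) (φ : B →⋆ₐ[ℂ] C) :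
    AnyonicFamily ω fun i j => φ (b i j) where
  zero_left i := by rw [hb.zero_left]; split_ifs <;> simp
  zero_right i := by rw [hb.zero_right]; split_ifs <;> simp
  adj i j := by rw [← map_star, hb.adj, map_smul]
  right i j k := by rw [hb.right, map_sum]; simp only [map_smul, map_mul]
  left i j k := by rw [hb.left, map_sum]; simp only [map_smul, map_mul]

theorem AnyonicFamily.sum_star_mul {B : Type*} [Ring B] [StarRing B] [Algebra ℂ B]
    {b : ZMod N → ZMod N → B} (hb : AnyonicFamily ω b) (i j : ZMod N) :
    ∑ k, star (b k i) * b k j = if i = j then 1 else 0 := by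
  have h := hb.right (-i) j 0
  rw [hb.zero_left] at h
  refine Eq.trans ?_ (h.symm.trans ?_)
  · refine Finset.sum_congr rfl fun k _ => ?_
    rw [hb.adj, smul_mul_assoc]
    congr 2 <;> ring_nf
  · simp only [neg_add_eq_zero]

theorem AnyonicFamily.sum_mul_star {B : Type*} [Ring B] [StarRing B] [Algebra ℂ B]
    {b : ZMod N → ZMod N → B} (hω : IsPrimitiveRoot ω N) (hb : AnyonicFamily ω b)
    (i j : ZMod N) : ∑ k, b i k * star (b j k) = if i = j then 1 else 0 := by
  have h := hb.left (-j) i 0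
  rw [hb.zero_right] at h
  have hadj : ∑ k, b i k * star (b j k)
      = zpw ω (j * i - j * j) • ∑ l, zpw ω (-(-j * (l - i))) • (b i l * b (-j) (0 - l)) := by
    rw [Finset.smul_sum]
    refine Finset.sum_congr rfl fun k _ => ?_
    rw [hb.adj, mul_smul_comm, smul_smul, ← zpw_add hω]
    congr 2 <;> ring_nf
  rw [hadj, ← h]
  by_cases hij : i = j
  · simp [hij, zpw_zero]
  · rw [if_neg hij, if_neg, smul_zero]
    rwa [neg_add_eq_zero, eq_comm]

end Universal

/-! ### Orthogonal decompositions into isometric copies -/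

section Decomposition

open ContinuousLinearMap (adjoint)

variable {K E K' E' K'' E'' F : Type*} [NormedAddCommGroup K] [InnerProductSpace ℂ K]
  [CompleteSpace K] [NormedAddCommGroup E] [InnerProductSpace ℂ E] [CompleteSpace E]
  [NormedAddCommGroup K'] [InnerProductSpace ℂ K']
  [NormedAddCommGroup E'] [InnerProductSpace ℂ E']
  [NormedAddCommGroup K''] [InnerProductSpace ℂ K'']
  [NormedAddCommGroup E''] [InnerProductSpace ℂ E'']
  [NormedAddCommGroup F] [InnerProductSpace ℂ F]
  {ι : Type*} [Fintype ι]

/-- The operator `E → E'` that acts as `T` between the `i`-th copies of `K` and `K'`, when the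
isometries `κ i` and `κ' i` decompose `E` and `E'`. -/
def ampl (κ : ι → K →L[ℂ] E) (κ' : ι → K' →L[ℂ] E') (T : K →L[ℂ] K') : E →L[ℂ] E' :=
  ∑ i, κ' i ∘L T ∘L adjoint (κ i)

theorem adjoint_ampl [CompleteSpace K'] [CompleteSpace E'] (κ : ι → K →L[ℂ] E)
    (κ' : ι → K' →L[ℂ] E') (T : K →L[ℂ] K') : adjoint (ampl κ κ' T) = ampl κ' κ (adjoint T) := by
  simp only [ampl, map_sum, ContinuousLinearMap.adjoint_comp,
    ContinuousLinearMap.adjoint_adjoint, ContinuousLinearMap.comp_assoc]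

variable [DecidableEq ι]

/-- The operators `κ i` are isometries of `K` onto mutually orthogonal subspaces whose sum is
`E`. -/
structure IsDecomposition (κ : ι → K →L[ℂ] E) : Prop where
  adjoint_comp : ∀ i j, adjoint (κ i) ∘L κ j = if i = j then 1 else 0
  sum_comp : ∑ i, κ i ∘L adjoint (κ i) = 1

theorem isDecomposition_ket {H : Type*} [NormedAddCommGroup H] [InnerProductSpace ℂ H]
    (b : OrthonormalBasis ι ℂ H) : IsDecomposition fun i => ket K (b i) where
  adjoint_comp i j := by
    rw [adjoint_ket_comp_ket, orthonormal_iff_ite.mp b.orthonormal]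
    split_ifs <;> simp
  sum_comp := sum_ket_comp_adjoint_ket b

namespace IsDecomposition

variable {κ : ι → K →L[ℂ] E} {κ' : ι → K' →L[ℂ] E'} {κ'' : ι → K'' →L[ℂ] E''}

theorem comp_eq_sum (h : IsDecomposition κ) (T : E →L[ℂ] F) :
    T = ∑ i, (T ∘L κ i) ∘L adjoint (κ i) := by
  conv_lhs => rw [← ContinuousLinearMap.comp_id T, ← ContinuousLinearMap.one_def, ← h.sum_comp,
    ContinuousLinearMap.comp_finsetSum]
  simp only [ContinuousLinearMap.comp_assoc]

theorem eq_sum_comp (h : IsDecomposition κ) (T : F →L[ℂ] E) :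
    T = ∑ i, κ i ∘L adjoint (κ i) ∘L T := by
  conv_lhs => rw [← ContinuousLinearMap.id_comp T, ← ContinuousLinearMap.one_def, ← h.sum_comp,
    ContinuousLinearMap.finsetSum_comp]
  simp only [ContinuousLinearMap.comp_assoc]

protected theorem ext (h : IsDecomposition κ) {S T : E →L[ℂ] F}
    (hST : ∀ i, S ∘L κ i = T ∘L κ i) : S = T := by
  rw [h.comp_eq_sum S, h.comp_eq_sum T]
  simp only [hST]

theorem ext_matrix (h : IsDecomposition κ) {S T : E →L[ℂ] E}
    (hST : ∀ i j, adjoint (κ i) ∘L S ∘L κ j = adjoint (κ i) ∘L T ∘L κ j) : S = T :=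
  h.ext fun j => by
    rw [h.eq_sum_comp (S ∘L κ j), h.eq_sum_comp (T ∘L κ j)]
    simp only [hST]

theorem comp_right [CompleteSpace K'] (h : IsDecomposition κ) {u : ι → K' →L[ℂ] K}
    (hu : ∀ i, adjoint (u i) ∘L u i = 1) (hu' : ∀ i, u i ∘L adjoint (u i) = 1) :
    IsDecomposition fun i => κ i ∘L u i where
  adjoint_comp i j := by
    rw [ContinuousLinearMap.adjoint_comp, ContinuousLinearMap.comp_assoc,
      ← ContinuousLinearMap.comp_assoc (adjoint (κ i)), h.adjoint_comp]
    rcases eq_or_ne i j with rfl | hij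
    · rw [if_pos rfl, if_pos rfl]
      exact hu i
    · rw [if_neg hij, if_neg hij, ContinuousLinearMap.zero_comp, ContinuousLinearMap.comp_zero]
  sum_comp := by
    rw [← h.sum_comp]
    refine Finset.sum_congr rfl fun i _ => ?_
    rw [ContinuousLinearMap.adjoint_comp, ContinuousLinearMap.comp_assoc,
      ← ContinuousLinearMap.comp_assoc (u i), hu']
    rfl

theorem opTensor_one_left (h : IsDecomposition κ) (H : Type*) [NormedAddCommGroup H]
    [InnerProductSpace ℂ H] [CompleteSpace H] :
    IsDecomposition fun i => opTensor (1 : H →L[ℂ] H) (κ i) where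
  adjoint_comp i j := by
    rw [adjoint_opTensor, opTensor_comp, h.adjoint_comp, ← ContinuousLinearMap.star_eq_adjoint,
      star_one]
    split_ifs
    · exact opTensor_one
    · exact opTensor_zero_right _
  sum_comp := by
    simp only [adjoint_opTensor, opTensor_comp,
      ← ContinuousLinearMap.star_eq_adjoint (1 : H →L[ℂ] H), star_one]
    rw [← opTensor_sum_right, h.sum_comp]
    exact opTensor_one

theorem opTensor_one_right (h : IsDecomposition κ) (H : Type*) [NormedAddCommGroup H]
    [InnerProductSpace ℂ H] [CompleteSpace H] :
    IsDecomposition fun i => opTensor (κ i) (1 : H →L[ℂ] H) where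
  adjoint_comp i j := by
    rw [adjoint_opTensor, opTensor_comp, h.adjoint_comp, ← ContinuousLinearMap.star_eq_adjoint,
      star_one]
    split_ifs
    · exact opTensor_one
    · exact opTensor_zero_left _
  sum_comp := by
    simp only [adjoint_opTensor, opTensor_comp,
      ← ContinuousLinearMap.star_eq_adjoint (1 : H →L[ℂ] H), star_one]
    rw [← opTensor_sum_left, h.sum_comp]
    exact opTensor_one

theorem ampl_comp (h : IsDecomposition κ) (κ' : ι → K' →L[ℂ] E') (T : K →L[ℂ] K') (j : ι) :
    ampl κ κ' T ∘L κ j = κ' j ∘L T := by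
  simp only [ampl, ContinuousLinearMap.finsetSum_comp, ContinuousLinearMap.comp_assoc,
    h.adjoint_comp]
  rw [Finset.sum_eq_single j (fun i _ hi => by simp [hi]) (by simp), if_pos rfl]
  rfl

theorem ampl_eq (h : IsDecomposition κ) {T : K →L[ℂ] K'} {G : E →L[ℂ] E'}
    (hG : ∀ i, G ∘L κ i = κ' i ∘L T) : ampl κ κ' T = G :=
  h.ext fun i => (h.ampl_comp κ' T i).trans (hG i).symm

theorem ampl_comp_ampl [CompleteSpace K'] [CompleteSpace E'] (h : IsDecomposition κ)
    (h' : IsDecomposition κ') (S : K' →L[ℂ] K'') (T : K →L[ℂ] K') :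
    ampl κ' κ'' S ∘L ampl κ κ' T = ampl κ κ'' (S ∘L T) :=
  (h.ampl_eq fun i => by
    rw [ContinuousLinearMap.comp_assoc, h.ampl_comp, ← ContinuousLinearMap.comp_assoc,
      h'.ampl_comp, ContinuousLinearMap.comp_assoc]).symm

theorem ampl_one (h : IsDecomposition κ) : ampl κ κ 1 = 1 := h.ampl_eq fun _ => rfl

/-- Amplification along a decomposition as a `*`-homomorphism. -/
def amplHom (h : IsDecomposition κ) : (K →L[ℂ] K) →⋆ₐ[ℂ] (E →L[ℂ] E) where
  toFun := ampl κ κ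
  map_one' := h.ampl_one
  map_mul' S T := (h.ampl_comp_ampl h S T).symm
  map_zero' := by simp [ampl]
  map_add' S T := by simp [ampl, Finset.sum_add_distrib]
  commutes' r := h.ampl_eq fun i => by
    simp only [Algebra.algebraMap_eq_smul_one, ContinuousLinearMap.smul_comp,
      ContinuousLinearMap.comp_smul]
    rfl
  map_star' T := (adjoint_ampl κ κ T).symm

theorem amplHom_eq (h : IsDecomposition κ) {T : K →L[ℂ] K} {G : E →L[ℂ] E}
    (hG : ∀ i, G ∘L κ i = κ i ∘L T) : h.amplHom T = G :=
  h.ampl_eq hG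

variable {A : Type*} [Ring A] [StarRing A] [Algebra ℂ A]

/-- The representation of matrices over `A` on `E = ⨁ᵢ K` induced by a representation of `A`
on `K`; it carries representations over to matrix algebras without a choice of `C*`-norm there. -/
def matrixRep (h : IsDecomposition κ) (f : A →⋆ₐ[ℂ] (K →L[ℂ] K)) :
    Matrix ι ι A →⋆ₐ[ℂ] (E →L[ℂ] E) :=
  let F (C : Matrix ι ι A) : E →L[ℂ] E := ∑ i, ∑ j, κ i ∘L f (C i j) ∘L adjoint (κ j)
  have hF (C : Matrix ι ι A) (j : ι) : F C ∘L κ j = ∑ i, κ i ∘L f (C i j) := by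
    simp only [F, ContinuousLinearMap.finsetSum_comp, ContinuousLinearMap.comp_assoc,
      h.adjoint_comp]
    refine Finset.sum_congr rfl fun i _ => ?_
    rw [Finset.sum_eq_single j (fun k _ hk => by simp [hk]) (by simp), if_pos rfl]
    rfl
  { toFun := F
    map_one' := h.ext fun j => by
      rw [hF, Finset.sum_eq_single j (fun k _ hk => by simp [hk]) (by simp), Matrix.one_apply_eq,
        map_one]
      rfl
    map_mul' := fun C D => h.ext fun j => by
      rw [ContinuousLinearMap.mul_def, ContinuousLinearMap.comp_assoc, hF, hF]
      simp only [Matrix.mul_apply, map_sum, map_mul, ContinuousLinearMap.comp_finsetSum,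
        ← ContinuousLinearMap.comp_assoc, hF, ContinuousLinearMap.finsetSum_comp]
      exact Finset.sum_comm
    map_zero' := by simp [F]
    map_add' := fun C D => by simp [F, Finset.sum_add_distrib]
    commutes' := fun r => h.ext fun j => by
      rw [hF, Finset.sum_eq_single j (fun k _ hk => by simp [Matrix.algebraMap_matrix_apply, hk])
        (by simp), Matrix.algebraMap_matrix_apply, if_pos rfl, AlgHomClass.commutes]
      simp only [Algebra.algebraMap_eq_smul_one, ContinuousLinearMap.smul_comp,
        ContinuousLinearMap.comp_smul]
      rfl
    map_star' := fun C => by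
      simp only [F, ContinuousLinearMap.star_eq_adjoint, map_sum, Matrix.star_apply, map_star,
        ContinuousLinearMap.adjoint_comp, ContinuousLinearMap.adjoint_adjoint,
        ContinuousLinearMap.comp_assoc]
      exact Finset.sum_comm }

variable (h : IsDecomposition κ) (f : A →⋆ₐ[ℂ] (K →L[ℂ] K))

theorem adjoint_comp_matrixRep_comp (C : Matrix ι ι A) (i j : ι) :
    adjoint (κ i) ∘L h.matrixRep f C ∘L κ j = f (C i j) := by
  change adjoint (κ i) ∘L (∑ k, ∑ l, κ k ∘L f (C k l) ∘L adjoint (κ l)) ∘L κ j = _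
  simp only [ContinuousLinearMap.finsetSum_comp, ContinuousLinearMap.comp_finsetSum,
    ContinuousLinearMap.comp_assoc, h.adjoint_comp]
  simp only [← ContinuousLinearMap.comp_assoc, h.adjoint_comp]
  rw [Finset.sum_eq_single i (fun k _ hk => by simp [hk.symm]) (by simp),
    Finset.sum_eq_single j (fun k _ hk => by simp [hk]) (by simp), if_pos rfl, if_pos rfl]
  rfl

theorem matrixRep_eq {C : Matrix ι ι A} {G : E →L[ℂ] E}
    (hG : ∀ j, G ∘L κ j = ∑ i, κ i ∘L f (C i j)) : h.matrixRep f C = G := by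
  refine h.ext_matrix fun i j => ?_
  rw [adjoint_comp_matrixRep_comp, hG, ContinuousLinearMap.comp_finsetSum]
  simp only [← ContinuousLinearMap.comp_assoc, h.adjoint_comp]
  rw [Finset.sum_eq_single i (fun k _ hk => by simp [hk.symm]) (by simp), if_pos rfl]
  rfl

theorem matrixRep_injective (hf : Function.Injective f) :
    Function.Injective (h.matrixRep f) := fun C D hCD => by
  ext i j
  apply hf
  rw [← h.adjoint_comp_matrixRep_comp f C, hCD, adjoint_comp_matrixRep_comp]

theorem mem_range_matrixRep {T : E →L[ℂ] E} :
    T ∈ Set.range (h.matrixRep f) ↔ ∀ i j, adjoint (κ i) ∘L T ∘L κ j ∈ Set.range f := by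
  refine ⟨?_, fun hT => ?_⟩
  · rintro ⟨C, rfl⟩ i j
    exact ⟨C i j, (h.adjoint_comp_matrixRep_comp f C i j).symm⟩
  · choose C hC using hT
    exact ⟨Matrix.of C, h.ext_matrix fun i j => by rw [adjoint_comp_matrixRep_comp]; exact hC i j⟩

theorem isClosed_range_matrixRep (hf : IsClosed (Set.range f)) :
    IsClosed (Set.range (h.matrixRep f)) := by
  have hrange : Set.range (h.matrixRep f) =
      ⋂ i, ⋂ j, (fun T : E →L[ℂ] E => adjoint (κ i) ∘L T ∘L κ j) ⁻¹' Set.range f := by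
    ext T
    simp only [mem_range_matrixRep, Set.mem_iInter, Set.mem_preimage]
  rw [hrange]
  exact isClosed_iInter fun i => isClosed_iInter fun j => hf.preimage (by fun_prop)

end IsDecomposition

section Assoc

variable {ι : Type*} [Fintype ι] {G : Type*} [NormedAddCommGroup G] [InnerProductSpace ℂ G]
  (b : OrthonormalBasis ι ℂ G) (H K : Type*) [NormedAddCommGroup H] [InnerProductSpace ℂ H]
  [NormedAddCommGroup K] [InnerProductSpace ℂ K]

/-- The reassociation `x ⊗ (y ⊗ z) ↦ (x ⊗ y) ⊗ z`, written as an amplification along an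
orthonormal basis of the first factor to make its unitarity evident. -/
def assocOp : HTensor G (HTensor H K) →L[ℂ] HTensor (HTensor G H) K :=
  ampl (fun i => ket (HTensor H K) (b i)) (fun i => opTensor (ket H (b i)) (1 : K →L[ℂ] K)) 1

variable {H K} in
theorem assocOp_tmul (x : G) (y : H) (z : K) :
    assocOp b H K (HTensor.tmul x (HTensor.tmul y z)) =
      HTensor.tmul (HTensor.tmul x y) z := by
  conv_rhs => rw [← b.sum_repr' x, HTensor.sum_tmul, HTensor.sum_tmul]
  simp [assocOp, ampl, adjoint_ket_tmul, HTensor.smul_tmul]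

variable {H K} in
theorem assocOp_comp_opTensor (x : G →L[ℂ] G) (y : H →L[ℂ] H) (z : K →L[ℂ] K) :
    assocOp b H K ∘L opTensor x (opTensor y z) =
      opTensor (opTensor x y) z ∘L assocOp b H K := by
  classical
  exact (isDecomposition_ket b).ext fun i => HTensor.ext fun v w => by simp [assocOp_tmul]

variable [CompleteSpace H] [CompleteSpace K]

theorem adjoint_assocOp_comp_assocOp : adjoint (assocOp b H K) ∘L assocOp b H K = 1 := by
  classical
  have h := isDecomposition_ket (K := HTensor H K) b
  have h' := (isDecomposition_ket (K := H) b).opTensor_one_right K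
  rw [assocOp, adjoint_ampl, h.ampl_comp_ampl h', ← ContinuousLinearMap.star_eq_adjoint, star_one]
  exact h.ampl_one

theorem assocOp_comp_adjoint_assocOp : assocOp b H K ∘L adjoint (assocOp b H K) = 1 := by
  classical
  have h := isDecomposition_ket (K := HTensor H K) b
  have h' := (isDecomposition_ket (K := H) b).opTensor_one_right K
  rw [assocOp, adjoint_ampl, h'.ampl_comp_ampl h, ← ContinuousLinearMap.star_eq_adjoint, star_one]
  exact h'.ampl_one

end Assoc

end Decomposition

/-! ### Spectral decomposition of a representation of `ℤ/N` -/

namespace ZNAlg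

section Spectral

variable {N : ℕ} (X : ZNAlg.{u} N)

/-- The unitary operator implementing `t ∈ ℤ/N`, indexed additively. -/
def V (t : ZMod N) : X.H →L[ℂ] X.H := X.U (Multiplicative.ofAdd t)

theorem V_zero : X.V 0 = 1 := by simp [V]

theorem V_mul (s t : ZMod N) : X.V s * X.V t = X.V (s + t) := by
  simp [V]

theorem star_V (t : ZMod N) : star (X.V t) = X.V (-t) := by
  rw [V, V, ofAdd_neg, map_inv, ← Unitary.coe_star, Unitary.star_eq_inv]

theorem coe_act (t : ZMod N) (a : X.A) :
    (X.act t a : X.H →L[ℂ] X.H) = X.V t * a * X.V (-t) := by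
  rw [← star_V]
  exact Unitary.conjStarAlgAut_apply _ _

/-- The action of `t ∈ ℤ/N` as a `*`-homomorphism. -/
def actHom (t : ZMod N) : X.A →⋆ₐ[ℂ] X.A where
  toFun := X.act t
  map_one' := Subtype.ext (map_one _)
  map_mul' _ _ := Subtype.ext (map_mul _ _ _)
  map_zero' := Subtype.ext (map_zero _)
  map_add' _ _ := Subtype.ext (map_add _ _ _)
  commutes' r := Subtype.ext (AlgHomClass.commutes
    (Unitary.conjStarAlgAut ℂ (X.H →L[ℂ] X.H) (X.U (Multiplicative.ofAdd t))) r)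
  map_star' a := Subtype.ext (map_star
    (Unitary.conjStarAlgAut ℂ (X.H →L[ℂ] X.H) (X.U (Multiplicative.ofAdd t))) (a : X.H →L[ℂ] X.H))

theorem actHom_apply (t : ZMod N) (a : X.A) : X.actHom t a = X.act t a := rfl

theorem act_act (s t : ZMod N) (a : X.A) : X.act s (X.act t a) = X.act (s + t) a :=
  Subtype.ext <| by
    simp only [coe_act, ← V_mul, neg_add_rev, mul_assoc]

theorem act_zero (a : X.A) : X.act 0 a = a :=
  Subtype.ext <| by rw [coe_act, neg_zero, V_zero, one_mul, mul_one]

variable [NeZero N] {ω : ℂ}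

theorem proj_eq (m : ZMod N) :
    X.proj ω m = (N : ℂ)⁻¹ • ∑ t : ZMod N, zpw ω (-(t * m)) • X.V t := rfl

theorem V_proj (hω : IsPrimitiveRoot ω N) (m t : ZMod N) :
    X.V t * X.proj ω m = zpw ω (t * m) • X.proj ω m := by
  rw [proj_eq, mul_smul_comm, smul_comm]
  congr 1
  rw [Finset.mul_sum, Finset.smul_sum, ← Equiv.sum_comp (Equiv.addLeft t)
    fun s => zpw ω (t * m) • zpw ω (-(s * m)) • X.V s]
  refine Finset.sum_congr rfl fun s _ => ?_
  rw [mul_smul_comm, V_mul, smul_smul, ← zpw_add hω, Equiv.coe_addLeft]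
  congr 2
  ring

theorem sum_proj (hω : IsPrimitiveRoot ω N) : ∑ m, X.proj ω m = 1 := by
  simp only [proj_eq, ← neg_mul]
  rw [← Finset.smul_sum, Finset.sum_comm]
  simp only [← Finset.sum_smul, sum_zpw_mul_left hω, neg_eq_zero, ite_smul, zero_smul,
    Finset.sum_ite_eq', Finset.mem_univ, if_true, V_zero]
  rw [smul_smul, inv_mul_cancel₀ (NeZero.ne _), one_smul]

theorem V_eq (hω : IsPrimitiveRoot ω N) (t : ZMod N) :
    X.V t = ∑ m, zpw ω (t * m) • X.proj ω m := by
  rw [← mul_one (X.V t), ← X.sum_proj hω, Finset.mul_sum]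
  exact Finset.sum_congr rfl fun m _ => X.V_proj hω m t

theorem proj_mul_proj (hω : IsPrimitiveRoot ω N) (m n : ZMod N) :
    X.proj ω m * X.proj ω n = if m = n then X.proj ω m else 0 := by
  rw [proj_eq X m, smul_mul_assoc, Finset.sum_mul]
  simp only [smul_mul_assoc, X.V_proj hω, smul_smul, ← zpw_add hω, neg_add_eq_sub, ← mul_sub]
  rw [← Finset.sum_smul, sum_zpw_mul_right hω]
  rcases eq_or_ne m n with rfl | hmn
  · rw [if_pos (sub_self m), if_pos rfl, smul_smul, inv_mul_cancel₀ (NeZero.ne _), one_smul,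
      proj_eq]
  · rw [if_neg (sub_ne_zero.mpr hmn.symm), if_neg hmn, zero_smul, smul_zero]

theorem star_proj (hω : IsPrimitiveRoot ω N) (m : ZMod N) :
    star (X.proj ω m) = X.proj ω m := by
  simp only [proj_eq, star_smul, star_sum, star_V, star_zpw hω]
  rw [← Equiv.sum_comp (Equiv.neg _)]
  simp

end Spectral

/-! ### Homogeneous elements -/

section Homogeneous

variable {N : ℕ} {ω : ℂ} {X : ZNAlg.{u} N}

/-- `a` is homogeneous of degree `d`, that is, `t ∈ ℤ/N` acts on it as `ω ^ (t * d)`. -/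
def IsHomogeneous (ω : ℂ) (a : X.A) (d : ZMod N) : Prop := ∀ t, X.act t a = zpw ω (t * d) • a

theorem IsHomogeneous.sum {ι : Type*} {s : Finset ι} {a : ι → X.A} {d : ZMod N}
    (ha : ∀ i ∈ s, IsHomogeneous ω (a i) d) : IsHomogeneous ω (∑ i ∈ s, a i) d := by
  intro t
  rw [← actHom_apply, map_sum, Finset.smul_sum]
  exact Finset.sum_congr rfl fun i hi => ha i hi t

theorem IsHomogeneous.V_mul {x : X.A} {d : ZMod N} (hx : IsHomogeneous ω x d) (t : ZMod N) :
    X.V t * (x : X.H →L[ℂ] X.H) = zpw ω (t * d) • ((x : X.H →L[ℂ] X.H) * X.V t) := by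
  have h : X.V t * (x : X.H →L[ℂ] X.H) * X.V (-t) = zpw ω (t * d) • (x : X.H →L[ℂ] X.H) :=
    (X.coe_act t x).symm.trans (congrArg Subtype.val (hx t))
  rw [← smul_mul_assoc, ← h, mul_assoc _ (X.V (-t)), ZNAlg.V_mul, neg_add_cancel, V_zero, mul_one]

variable [NeZero N]

theorem IsHomogeneous.mul (hω : IsPrimitiveRoot ω N) {a b : X.A} {d e : ZMod N}
    (ha : IsHomogeneous ω a d) (hb : IsHomogeneous ω b e) : IsHomogeneous ω (a * b) (d + e) := by
  intro t
  rw [← actHom_apply, map_mul, actHom_apply, actHom_apply, ha, hb, smul_mul_smul_comm,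
    ← zpw_add hω, mul_add]

theorem IsHomogeneous.proj_mul (hω : IsPrimitiveRoot ω N) {x : X.A} {d : ZMod N}
    (hx : IsHomogeneous ω x d) (m : ZMod N) :
    X.proj ω (m + d) * (x : X.H →L[ℂ] X.H) = (x : X.H →L[ℂ] X.H) * X.proj ω m := by
  simp only [proj_eq, smul_mul_assoc, mul_smul_comm, Finset.sum_mul, Finset.mul_sum, hx.V_mul,
    smul_smul, ← zpw_add hω]
  congr 1
  refine Finset.sum_congr rfl fun t _ => ?_
  congr 2
  ring

theorem exists_sum_isHomogeneous (hω : IsPrimitiveRoot ω N) (a : X.A) :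
    ∃ c : ZMod N → X.A, (∀ d, IsHomogeneous ω (c d) d) ∧ ∑ d, c d = a := by
  refine ⟨fun d => (N : ℂ)⁻¹ • ∑ t : ZMod N, zpw ω (-(t * d)) • X.act t a, fun d s => ?_, ?_⟩
  · rw [← actHom_apply, map_smul, map_sum, smul_comm (zpw ω (s * d))]
    congr 1
    rw [Finset.smul_sum,
      ← Equiv.sum_comp (Equiv.addLeft s) fun t => zpw ω (s * d) • zpw ω (-(t * d)) • X.act t a]
    refine Finset.sum_congr rfl fun t _ => ?_
    rw [map_smul, actHom_apply, act_act, smul_smul, ← zpw_add hω, Equiv.coe_addLeft]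
    congr 2
    ring
  · simp only [← neg_mul]
    rw [← Finset.smul_sum, Finset.sum_comm]
    simp only [← Finset.sum_smul, sum_zpw_mul_left hω, neg_eq_zero, ite_smul, zero_smul,
      Finset.sum_ite_eq', Finset.mem_univ, if_true, act_zero]
    rw [smul_smul, inv_mul_cancel₀ (NeZero.ne _), one_smul]

end Homogeneous

/-! ### Block diagonal operators -/

section BlockDiag

variable {N : ℕ} [NeZero N] {ω : ℂ} (X : ZNAlg.{u} N) {K : Type*} [NormedAddCommGroup K]
  [InnerProductSpace ℂ K]

/-- The operator on `X.H ⊗ K` that acts as `f m` on the second factor over the eigenspace of weight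
`m`; controlled operations such as `opj₂` have this form. -/
def blockDiag (ω : ℂ) (f : ZMod N → K →L[ℂ] K) : HTensor X.H K →L[ℂ] HTensor X.H K :=
  ∑ m, opTensor (X.proj ω m) (f m)

theorem blockDiag_const (hω : IsPrimitiveRoot ω N) (b : K →L[ℂ] K) :
    X.blockDiag ω (fun _ => b) = opTensor 1 b := by
  rw [blockDiag, ← opTensor_sum_left, X.sum_proj hω]

theorem blockDiag_zpw_smul (hω : IsPrimitiveRoot ω N) (t : ZMod N) (b : K →L[ℂ] K) :
    X.blockDiag ω (fun m => zpw ω (t * m) • b) = opTensor (X.V t) b := by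
  simp only [blockDiag, X.V_eq hω t, opTensor_sum_left, opTensor_smul_left, opTensor_smul_right]

theorem blockDiag_mul_opTensor {X : ZNAlg.{u} N} (hω : IsPrimitiveRoot ω N) {x : X.A} {d : ZMod N}
    (hx : IsHomogeneous ω x d) (f : ZMod N → K →L[ℂ] K) :
    X.blockDiag ω f * opTensor (x : X.H →L[ℂ] X.H) 1 =
      opTensor (x : X.H →L[ℂ] X.H) 1 * X.blockDiag ω fun m => f (m + d) := by
  simp only [blockDiag, Finset.sum_mul, Finset.mul_sum, opTensor_mul, mul_one, one_mul,
    ← hx.proj_mul hω]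
  exact (Equiv.sum_comp (Equiv.addRight d) fun m =>
    opTensor (X.proj ω m * (x : X.H →L[ℂ] X.H)) (f m)).symm

variable [CompleteSpace K]

/-- Block diagonal operators form the image of a `*`-homomorphism. -/
def blockDiagHom (hω : IsPrimitiveRoot ω N) :
    (ZMod N → K →L[ℂ] K) →⋆ₐ[ℂ] (HTensor X.H K →L[ℂ] HTensor X.H K) where
  toFun := X.blockDiag ω
  map_one' := (X.blockDiag_const hω 1).trans opTensor_one
  map_mul' f g := by
    simp only [blockDiag, Finset.sum_mul_sum, opTensor_mul, X.proj_mul_proj hω]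
    refine Finset.sum_congr rfl fun m _ => ?_
    rw [Finset.sum_eq_single m, if_pos rfl, Pi.mul_apply]
    · intro n _ hn
      rw [if_neg hn.symm, opTensor_zero_left]
    · simp
  map_zero' := by simp [blockDiag, opTensor_zero_right]
  map_add' f g := by simp [blockDiag, opTensor_add_right, Finset.sum_add_distrib]
  commutes' r := by
    change X.blockDiag ω (fun _ => algebraMap ℂ _ r) = _
    rw [X.blockDiag_const hω, Algebra.algebraMap_eq_smul_one, opTensor_smul_right, opTensor_one,
      Algebra.algebraMap_eq_smul_one]
  map_star' f := by simp only [blockDiag, star_sum, star_opTensor, X.star_proj hω, Pi.star_apply]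

theorem blockDiagHom_apply (hω : IsPrimitiveRoot ω N) (f : ZMod N → K →L[ℂ] K) :
    X.blockDiagHom hω f = X.blockDiag ω f := rfl

end BlockDiag

/-! ### The embeddings into the braided tensor product -/

section Embeddings

variable {N : ℕ} (X : ZNAlg.{u} N) (Y : ZNAlg.{v} N)

/-- The embedding `j₁` of operators as a `*`-homomorphism. -/
def opj₁Hom : (X.H →L[ℂ] X.H) →⋆ₐ[ℂ] (HTensor X.H Y.H →L[ℂ] HTensor X.H Y.H) where
  toFun := opj₁ X Y
  map_one' := opTensor_one
  map_mul' a b := by simp [opj₁, opTensor_mul]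
  map_zero' := opTensor_zero_left _
  map_add' a b := opTensor_add_left a b 1
  commutes' r := by
    rw [Algebra.algebraMap_eq_smul_one, opj₁, opTensor_smul_left, opTensor_one,
      Algebra.algebraMap_eq_smul_one]
  map_star' a := by rw [opj₁, opj₁, star_opTensor, star_one]

variable [NeZero N] {ω : ℂ}

theorem braid_eq (hω : IsPrimitiveRoot ω N) :
    braid ω X Y = flipOp X.H Y.H ∘L X.blockDiag ω Y.V := by
  rw [braid, blockDiag, ContinuousLinearMap.comp_finsetSum, ContinuousLinearMap.finsetSum_comp]
  refine Finset.sum_congr rfl fun m _ => ?_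
  rw [opTensor_flipOp, Y.V_eq hω, opTensor_sum_left]
  simp only [opTensor_smul_left]

theorem dualBraid_eq (hω : IsPrimitiveRoot ω N) :
    dualBraid ω X Y = X.blockDiag ω (fun m => Y.V (-m)) ∘L flipOp Y.H X.H := by
  rw [dualBraid, blockDiag]
  congr 1
  refine Finset.sum_congr rfl fun m _ => ?_
  rw [Y.V_eq hω, opTensor_sum_right]
  simp only [opTensor_smul_right, neg_mul]

theorem opj₂_eq (hω : IsPrimitiveRoot ω N) (y : Y.H →L[ℂ] Y.H) :
    opj₂ ω X Y y = X.blockDiag ω fun m => Y.V (-m) * y * Y.V m := by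
  calc opj₂ ω X Y y
      = X.blockDiag ω (fun m => Y.V (-m)) ∘L
          (flipOp Y.H X.H ∘L opTensor y 1 ∘L flipOp X.H Y.H) ∘L X.blockDiag ω Y.V := by
        rw [opj₂, braid_eq X Y hω, dualBraid_eq X Y hω]
        rfl
    _ = X.blockDiag ω (fun m => Y.V (-m)) * X.blockDiag ω (fun _ => y) * X.blockDiag ω Y.V := by
        rw [flipOp_opTensor_flipOp, X.blockDiag_const hω]
        rfl
    _ = X.blockDiag ω fun m => Y.V (-m) * y * Y.V m := by
        simp only [← X.blockDiagHom_apply hω, ← map_mul]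
        rfl

/-- The embedding `j₂` of operators as a `*`-homomorphism. -/
def opj₂Hom (hω : IsPrimitiveRoot ω N) :
    (Y.H →L[ℂ] Y.H) →⋆ₐ[ℂ] (HTensor X.H Y.H →L[ℂ] HTensor X.H Y.H) :=
  have hY (m : ZMod N) : Y.V m * Y.V (-m) = 1 := by rw [V_mul, add_neg_cancel, V_zero]
  have hY' (m : ZMod N) : Y.V (-m) * Y.V m = 1 := by rw [V_mul, neg_add_cancel, V_zero]
  { toFun := opj₂ ω X Y
    map_one' := by
      simp only [opj₂_eq X Y hω, mul_one, hY', X.blockDiag_const hω, opTensor_one]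
    map_mul' := fun a b => by
      simp only [opj₂_eq X Y hω, ← X.blockDiagHom_apply hω, ← map_mul]
      congr 1
      funext m
      simp only [Pi.mul_apply, mul_assoc]
      rw [← mul_assoc (Y.V m) (Y.V (-m)), hY, one_mul]
    map_zero' := by
      simp only [opj₂_eq X Y hω, mul_zero, zero_mul, X.blockDiag_const hω, opTensor_zero_right]
    map_add' := fun a b => by
      simp only [opj₂_eq X Y hω, ← X.blockDiagHom_apply hω, ← map_add, mul_add, add_mul]
      rfl
    commutes' := fun r => by
      simp only [opj₂_eq X Y hω, Algebra.algebraMap_eq_smul_one, mul_smul_comm, smul_mul_assoc,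
        mul_one, hY', X.blockDiag_const hω, opTensor_smul_right, opTensor_one]
    map_star' := fun a => by
      simp only [opj₂_eq X Y hω, ← X.blockDiagHom_apply hω, ← map_star]
      congr 1
      funext m
      simp only [Pi.star_apply, star_mul, star_V, neg_neg, mul_assoc] }

/-- The embedding `j₁` into the braided tensor product as a `*`-homomorphism. -/
def j₁Hom (ω : ℂ) : X.A →⋆ₐ[ℂ] (box ω X Y).A :=
  StarAlgHom.codRestrict ((opj₁Hom X Y).comp X.A.subtype) (box ω X Y).A
    fun x => opj₁_mem ω X Y x.2

theorem j₁Hom_apply (x : X.A) : j₁Hom X Y ω x = j₁ ω X Y x := rfl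

/-- The embedding `j₂` into the braided tensor product as a `*`-homomorphism. -/
def j₂Hom (hω : IsPrimitiveRoot ω N) : Y.A →⋆ₐ[ℂ] (box ω X Y).A :=
  StarAlgHom.codRestrict ((opj₂Hom X Y hω).comp Y.A.subtype) (box ω X Y).A
    fun y => opj₂_mem ω X Y y.2

theorem j₂Hom_apply (hω : IsPrimitiveRoot ω N) (y : Y.A) : j₂Hom X Y hω y = j₂ ω X Y y :=
  rfl

theorem act_j₁ (t : ZMod N) (x : X.A) : (box ω X Y).act t (j₁ ω X Y x) = j₁ ω X Y (X.act t x) :=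
  Subtype.ext (conj_opj₁ X Y _ _)

theorem act_j₂ (t : ZMod N) (y : Y.A) : (box ω X Y).act t (j₂ ω X Y y) = j₂ ω X Y (Y.act t y) :=
  Subtype.ext (conj_opj₂ ω X Y _ _)

variable {X Y}

theorem IsHomogeneous.j₁ {x : X.A} {d : ZMod N} (hx : IsHomogeneous ω x d) :
    IsHomogeneous ω (X := box ω X Y) (j₁ ω X Y x) d := by
  intro t
  rw [act_j₁, hx, ← j₁Hom_apply, map_smul]
  rfl

theorem IsHomogeneous.j₂ (hω : IsPrimitiveRoot ω N) {y : Y.A} {d : ZMod N}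
    (hy : IsHomogeneous ω y d) : IsHomogeneous ω (X := box ω X Y) (ZNAlg.j₂ ω X Y y) d := by
  intro t
  rw [act_j₂, hy, ← j₂Hom_apply X Y hω, map_smul]
  rfl

theorem opj₂_of_isHomogeneous (hω : IsPrimitiveRoot ω N) {y : Y.A} {d : ZMod N}
    (hy : IsHomogeneous ω y d) :
    opj₂ ω X Y (y : Y.H →L[ℂ] Y.H) = opTensor (X.V (-d)) (y : Y.H →L[ℂ] Y.H) := by
  rw [opj₂_eq X Y hω, ← X.blockDiag_zpw_smul hω]
  refine congrArg (X.blockDiag ω) (funext fun m => ?_)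
  rw [hy.V_mul, smul_mul_assoc, mul_assoc, V_mul, neg_add_cancel, V_zero, mul_one]
  congr 2
  ring

theorem j₂_mul_j₁ (hω : IsPrimitiveRoot ω N) {x : X.A} {y : Y.A} {d e : ZMod N}
    (hx : IsHomogeneous ω x e) (hy : IsHomogeneous ω y d) :
    j₂ ω X Y y * j₁ ω X Y x = zpw ω (-(d * e)) • (j₁ ω X Y x * j₂ ω X Y y) := by
  refine Subtype.ext ?_
  change opj₂ ω X Y y * opj₁ X Y x = zpw ω (-(d * e)) • (opj₁ X Y x * opj₂ ω X Y y)
  rw [opj₂_of_isHomogeneous hω hy, opj₁, opTensor_mul, opTensor_mul, hx.V_mul, opTensor_smul_left,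
    mul_one, one_mul, neg_mul]

theorem box_mem {B : Type*} [CStarAlgebra B] {C : StarSubalgebra ℂ B} (hC : IsClosed (C : Set B))
    (φ : (box ω X Y).A →⋆ₐ[ℂ] B) (h₁ : ∀ x, φ (ZNAlg.j₁ ω X Y x) ∈ C)
    (h₂ : ∀ y, φ (ZNAlg.j₂ ω X Y y) ∈ C) (a : (box ω X Y).A) : φ a ∈ C := by
  refine starAlgHom_mem_of_generators (s := boxGens ω X Y) hC φ ?_ a
  rintro ⟨_, _⟩ (⟨x, hx, rfl⟩ | ⟨y, hy, rfl⟩)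
  · exact h₁ ⟨x, hx⟩
  · exact h₂ ⟨y, hy⟩

end Embeddings

end ZNAlg

/-! ### The braided comultiplication -/

section BraidedProduct

variable {N : ℕ} [NeZero N] {ω : ℂ} {B : Type*} [Ring B] [StarRing B] [Algebra ℂ B]
  {p r : ZMod N → ZMod N → B}

theorem AnyonicFamily.braidedMul_right (hω : IsPrimitiveRoot ω N) (hp : AnyonicFamily ω p)
    (hr : AnyonicFamily ω r)
    (hcomm : ∀ k j a b, r k j * p a b = zpw ω (-((j - k) * (b - a))) • (p a b * r k j))
    (i j k : ZMod N) :
    ∑ m, p k m * r m (i + j) = ∑ l, zpw ω (-(l * (i - k + l))) •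
      ((∑ a, p (k - l) a * r a i) * ∑ b, p l b * r b j) := by
  have key : ∀ l a b, (p (k - l) a * r a i) * (p l b * r b j)
      = zpw ω (-((i - a) * (b - l))) • ((p (k - l) a * p l b) * (r a i * r b j)) := by
    intro l a b
    rw [mul_assoc, ← mul_assoc (r a i), hcomm, smul_mul_assoc, mul_smul_comm]
    simp only [mul_assoc]
  trans ∑ a, ∑ b, zpw ω (-((i - a) * b)) • (p k (a + b) * (r a i * r b j))
  · rw [Finset.sum_comm]
    simp only [hr.right, Finset.mul_sum, mul_smul_comm]
    refine Finset.sum_comm.trans (Finset.sum_congr rfl fun b _ => ?_)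
    rw [← Equiv.sum_comp (Equiv.addRight b)]
    refine Finset.sum_congr rfl fun a _ => ?_
    rw [Equiv.coe_addRight, add_sub_cancel_right]
    congr 2
    ring
  · symm
    simp only [Finset.sum_mul_sum, Finset.smul_sum, key]
    simp only [hp.right, smul_smul, Finset.sum_mul, Finset.smul_sum, smul_mul_assoc, ← zpw_add hω]
    refine Finset.sum_comm.trans (Finset.sum_congr rfl fun a _ => Finset.sum_comm.trans
      (Finset.sum_congr rfl fun b _ => Finset.sum_congr rfl fun l _ => ?_))
    congr 2
    ring

theorem AnyonicFamily.braidedMul_left (hω : IsPrimitiveRoot ω N) (hp : AnyonicFamily ω p)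
    (hr : AnyonicFamily ω r)
    (hcomm : ∀ k j a b, r k j * p a b = zpw ω (-((j - k) * (b - a))) • (p a b * r k j))
    (i j k : ZMod N) :
    ∑ m, p (i + j) m * r m k = ∑ l, zpw ω (-(i * (l - j))) •
      ((∑ a, p j a * r a l) * ∑ b, p i b * r b (k - l)) := by
  have key : ∀ l a b, (p j a * r a l) * (p i b * r b (k - l))
      = zpw ω (-((l - a) * (b - i))) • ((p j a * p i b) * (r a l * r b (k - l))) := by
    intro l a b
    rw [mul_assoc, ← mul_assoc (r a l), hcomm, smul_mul_assoc, mul_smul_comm]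
    simp only [mul_assoc]
  trans ∑ a, ∑ b, zpw ω (-(i * (a - j))) • ((p j a * p i b) * r (b + a) k)
  · simp only [hp.left, Finset.sum_mul, smul_mul_assoc]
    refine Finset.sum_comm.trans (Finset.sum_congr rfl fun a _ => ?_)
    rw [← Equiv.sum_comp (Equiv.addRight a)]
    refine Finset.sum_congr rfl fun b _ => ?_
    rw [Equiv.coe_addRight, add_sub_cancel_right]
  · symm
    simp only [Finset.sum_mul_sum, Finset.smul_sum, key]
    simp only [hr.left, smul_smul, Finset.mul_sum, Finset.smul_sum, mul_smul_comm, ← zpw_add hω]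
    refine Finset.sum_comm.trans (Finset.sum_congr rfl fun a _ => Finset.sum_comm.trans
      (Finset.sum_congr rfl fun b _ => Finset.sum_congr rfl fun l _ => ?_))
    congr 2
    ring

theorem AnyonicFamily.braidedMul (hω : IsPrimitiveRoot ω N) (hp : AnyonicFamily ω p)
    (hr : AnyonicFamily ω r)
    (hcomm : ∀ k j a b, r k j * p a b = zpw ω (-((j - k) * (b - a))) • (p a b * r k j)) :
    AnyonicFamily ω fun i j => ∑ k, p i k * r k j where
  zero_left i := by simp [hp.zero_left, hr.zero_left]
  zero_right i := by simp [hp.zero_right, hr.zero_right]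
  adj i j := by
    rw [star_sum, Finset.smul_sum, ← Equiv.sum_comp (Equiv.neg (ZMod N))
      (fun k => zpw ω (-(i * (i - j))) • (p (-i) k * r k (-j)))]
    refine Finset.sum_congr rfl fun k _ => ?_
    rw [Equiv.neg_apply, star_mul, hr.adj, hp.adj, smul_mul_smul_comm, hcomm, smul_smul,
      ← zpw_add hω, ← zpw_add hω]
    congr 2
    ring
  right i j k := hp.braidedMul_right hω hr hcomm i j k
  left i j k := hp.braidedMul_left hω hr hcomm i j k

end BraidedProduct

namespace EquivariantRep

variable {N : ℕ} [NeZero N] {ω : ℂ} (L : EquivariantRep.{u} N ω)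

/-- The representation as an isomorphism onto its image. -/
def opEquiv : CS N ω ≃⋆ₐ[ℂ] L.alg.A := StarAlgEquiv.ofInjective L.π L.injective

theorem opEquiv_apply (a : CS N ω) : L.opEquiv a = L.op a := rfl

theorem op_surjective : Function.Surjective L.op := L.opEquiv.surjective

theorem CS_hom_ext {B : Type*} [CStarAlgebra B] {φ ψ : CS N ω →⋆ₐ[ℂ] B}
    (h : ∀ i j, φ (q ω i j) = ψ (q ω i j)) : φ = ψ := by
  refine StarAlgHom.ext fun a => ?_
  exact CS.induction (StarAlgHom.equalizer φ ψ)
    (isClosed_eq (continuous_starAlgHom φ) (continuous_starAlgHom ψ)) h a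

theorem isHomogeneous_op (i j : ZMod N) :
    ZNAlg.IsHomogeneous ω (X := L.alg) (L.op (q ω i j)) (j - i) := fun t =>
  Subtype.ext (L.equivariant t i j)

theorem anyonicFamily_op : AnyonicFamily ω fun i j => L.op (q ω i j) :=
  anyonicFamily_q.map (L.opEquiv : CS N ω →⋆ₐ[ℂ] L.alg.A)

theorem exists_isBraidedComult (hω : IsPrimitiveRoot ω N) :
    ∃ Δ : CS N ω →⋆ₐ[ℂ] L.double.A, L.IsBraidedComult Δ := by
  have : IsClosed (L.double.A : Set (L.double.H →L[ℂ] L.double.H)) := L.double.isClosed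
  refine AnyonicFamily.exists_hom (B := L.double.A) (b := fun i j =>
    ∑ k, ZNAlg.j₁ ω L.alg L.alg (L.op (q ω i k)) * ZNAlg.j₂ ω L.alg L.alg (L.op (q ω k j))) ?_
  exact AnyonicFamily.braidedMul hω (L.anyonicFamily_op.map (ZNAlg.j₁Hom L.alg L.alg ω))
    (L.anyonicFamily_op.map (ZNAlg.j₂Hom L.alg L.alg hω)) fun k j a b =>
      ZNAlg.j₂_mul_j₁ hω (L.isHomogeneous_op a b) (L.isHomogeneous_op k j)

theorem IsBraidedComult.isHomogeneous (hω : IsPrimitiveRoot ω N) {Δ : CS N ω →⋆ₐ[ℂ] L.double.A}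
    (hΔ : L.IsBraidedComult Δ) (i j : ZMod N) :
    ZNAlg.IsHomogeneous ω (X := L.double) (Δ (q ω i j)) (j - i) := by
  rw [hΔ]
  refine ZNAlg.IsHomogeneous.sum fun k _ => ?_
  have h := (L.isHomogeneous_op i k).j₁.mul hω ((L.isHomogeneous_op k j).j₂ hω)
  rwa [sub_add_sub_cancel'] at h

theorem IsBraidedComult.map_act (hω : IsPrimitiveRoot ω N) {Δ : CS N ω →⋆ₐ[ℂ] L.double.A}
    (hΔ : L.IsBraidedComult Δ) (t : ZMod N) (a : L.alg.A) :
    Δ (L.opEquiv.symm (L.alg.act t a)) = L.double.act t (Δ (L.opEquiv.symm a)) := by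
  have : IsClosed (L.double.A : Set (L.double.H →L[ℂ] L.double.H)) := L.double.isClosed
  let σ : L.alg.A →⋆ₐ[ℂ] CS N ω := L.opEquiv.symm
  have hext : Δ.comp ((σ.comp (L.alg.actHom t)).comp (L.opEquiv : CS N ω →⋆ₐ[ℂ] L.alg.A)) =
      (L.double.actHom t).comp Δ := by
    refine CS_hom_ext fun i j => ?_
    change Δ (L.opEquiv.symm (L.alg.act t (L.op (q ω i j)))) = L.double.act t (Δ (q ω i j))
    rw [hΔ.isHomogeneous L hω, L.isHomogeneous_op, map_smul, ← L.opEquiv_apply,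
      StarAlgEquiv.symm_apply_apply, map_smul]
  obtain ⟨b, rfl⟩ : ∃ b, L.opEquiv b = a := L.opEquiv.surjective a
  rw [StarAlgEquiv.symm_apply_apply]
  exact DFunLike.congr_fun hext b

end EquivariantRep

/-! ### The Fourier basis of `ℓ²(ℤ/N)` -/

section Fourier

open ContinuousLinearMap (adjoint)

variable {N : ℕ}

/-- The normalized character `s ↦ ω ^ (m * s) / √N`; these diagonalize the regular
representation. -/
def chi (ω : ℂ) (m : ZMod N) : EuclideanSpace ℂ (ZMod N) :=
  ((Real.sqrt N : ℝ) : ℂ)⁻¹ • WithLp.toLp 2 fun s => zpw ω (m * s)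

theorem chi_apply (ω : ℂ) (m s : ZMod N) :
    chi ω m s = ((Real.sqrt N : ℝ) : ℂ)⁻¹ * zpw ω (m * s) := rfl

variable [NeZero N] {ω : ℂ}

theorem orthonormal_chi (hω : IsPrimitiveRoot ω N) : Orthonormal ℂ (chi (N := N) ω) := by
  rw [orthonormal_iff_ite]
  intro m n
  have hN : (((Real.sqrt N : ℝ) : ℂ)⁻¹ * ((Real.sqrt N : ℝ) : ℂ)⁻¹) * (N : ℂ) = 1 := by
    rw [← mul_inv, ← Complex.ofReal_mul, Real.mul_self_sqrt (Nat.cast_nonneg N),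
      Complex.ofReal_natCast, inv_mul_cancel₀ (NeZero.ne _)]
  have hterm (s : ZMod N) : ((Real.sqrt N : ℝ) : ℂ)⁻¹ * zpw ω (n * s)
      * (((Real.sqrt N : ℝ) : ℂ)⁻¹ * (starRingEnd ℂ) (zpw ω (m * s)))
      = (((Real.sqrt N : ℝ) : ℂ)⁻¹ * ((Real.sqrt N : ℝ) : ℂ)⁻¹) * zpw ω (s * (n - m)) := by
    rw [starRingEnd_apply, star_zpw hω, mul_mul_mul_comm, ← zpw_add hω]
    congr 2
    ring
  simp only [PiLp.inner_apply, chi_apply, RCLike.inner_apply, map_mul, map_inv₀,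
    Complex.conj_ofReal, hterm]
  rw [← Finset.mul_sum, sum_zpw_mul_right hω]
  rcases eq_or_ne m n with rfl | hmn
  · rw [if_pos rfl, if_pos (sub_self m), hN]
  · rw [if_neg hmn, if_neg (sub_ne_zero.mpr hmn.symm), mul_zero]

/-- The Fourier basis of `ℓ²(ℤ/N)`. -/
def chiBasis (hω : IsPrimitiveRoot ω N) : OrthonormalBasis (ZMod N) ℂ (CZ N).H :=
  OrthonormalBasis.mk (𝕜 := ℂ) (E := EuclideanSpace ℂ (ZMod N)) (orthonormal_chi hω) <|
    ((orthonormal_chi hω).linearIndependent.span_eq_top_of_card_eq_finrank (by simp)).ge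

theorem chiBasis_apply (hω : IsPrimitiveRoot ω N) (m : ZMod N) : chiBasis hω m = chi ω m :=
  congrFun (OrthonormalBasis.coe_mk (𝕜 := ℂ) (E := EuclideanSpace ℂ (ZMod N))
    (orthonormal_chi hω) _) m

theorem V_chiBasis (hω : IsPrimitiveRoot ω N) (m t : ZMod N) :
    (CZ N).V t (chiBasis hω m) = zpw ω (t * m) • chiBasis hω m := by
  rw [chiBasis_apply]
  refine PiLp.ext fun s => ?_
  refine (regU_apply N (Multiplicative.ofAdd t) (chi ω m) s).trans ?_
  change _ = zpw ω (t * m) * chi ω m s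
  rw [chi_apply, chi_apply, mul_left_comm, ← zpw_add hω, toAdd_ofAdd]
  congr 2
  ring

theorem fun_eq_sum_zpw (hω : IsPrimitiveRoot ω N) (f : ZMod N → ℂ) :
    f = ∑ d : ZMod N, ((N : ℂ)⁻¹ * ∑ t, f t * zpw ω (-(d * t))) • fun s => zpw ω (d * s) := by
  funext s
  have h (t : ZMod N) :
      ∑ d : ZMod N, zpw ω (-(d * t)) * zpw ω (d * s) = if t = s then (N : ℂ) else 0 := by
    simp only [← zpw_add hω, neg_add_eq_sub, ← mul_sub]
    simp only [sum_zpw_mul_right hω, sub_eq_zero, eq_comm (a := s)]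
  simp only [Finset.sum_apply, Pi.smul_apply, smul_eq_mul, mul_assoc, Finset.sum_mul]
  rw [← Finset.mul_sum, Finset.sum_comm]
  simp only [← Finset.mul_sum, h, mul_ite, mul_zero, Finset.sum_ite_eq', Finset.mem_univ, if_true]
  rw [mul_comm (f s), inv_mul_cancel_left₀ (NeZero.ne _)]

end Fourier

/-! ### Characters of `ℤ/N` as elements of `C(ℤ/N)` -/

namespace CZ

variable {N : ℕ} [NeZero N] {ω : ℂ}

/-- The inclusion of functions into `C(ℤ/N)` as a linear map. -/
def ofFunₗ (N : ℕ) [NeZero N] : (ZMod N → ℂ) →ₗ[ℂ] (CZ N).A where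
  toFun := ofFun N
  map_add' f g := Subtype.ext (map_add (mulOp N) f g)
  map_smul' r f := Subtype.ext (map_smul (mulOp N) r f)

/-- The character `s ↦ ω ^ (d * s)`, the `d`-th power of the generator `z` of `C(ℤ/N)`. -/
def char (ω : ℂ) (d : ZMod N) : (CZ N).A := ofFun N fun s => zpw ω (d * s)

theorem char_zero : char (N := N) ω 0 = 1 := by
  refine Subtype.ext ((congrArg (mulOp N) ?_).trans (map_one (mulOp N)))
  funext s
  rw [zero_mul, zpw_zero, Pi.one_apply]

theorem char_add (hω : IsPrimitiveRoot ω N) (d e : ZMod N) :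
    char ω (d + e) = char ω d * char ω e := by
  refine Subtype.ext ((congrArg (mulOp N) ?_).trans (map_mul (mulOp N) _ _))
  funext s
  rw [add_mul, zpw_add hω, Pi.mul_apply]

theorem star_char (hω : IsPrimitiveRoot ω N) (d : ZMod N) :
    star (char ω d) = char ω (-d) := by
  refine Subtype.ext ((map_star (mulOp N) _).symm.trans (congrArg (mulOp N) ?_))
  funext s
  rw [neg_mul, ← star_zpw hω, Pi.star_apply]

theorem char_eq_pow (hω : IsPrimitiveRoot ω N) (d : ZMod N) :
    char ω d = z N ω ^ d.val := by
  have h (n : ℕ) : char ω (n : ZMod N) = z N ω ^ n := by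
    induction n with
    | zero => rw [Nat.cast_zero, char_zero, pow_zero]
    | succ n ih =>
      rw [Nat.cast_succ, char_add hω, ih, pow_succ]
      congr 1
      refine congrArg (ofFun N) ?_
      funext s
      rw [one_mul]
  rw [← h, ZMod.natCast_zmod_val]

theorem isHomogeneous_char (hω : IsPrimitiveRoot ω N) (d : ZMod N) :
    ZNAlg.IsHomogeneous ω (X := CZ N) (char ω d) d := by
  intro t
  refine Subtype.ext ((regU_conj N (Multiplicative.ofAdd t) _).trans
    ((congrArg (mulOp N) ?_).trans (map_smul (mulOp N) _ _)))
  funext s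
  simp only [toAdd_ofAdd, Pi.smul_apply, smul_eq_mul, ← zpw_add hω]
  congr 1
  ring

theorem char_eq_sum_delta (d : ZMod N) :
    char ω d = ∑ t : ZMod N, zpw ω (t * d) • delta N t := by
  have h : (fun s => zpw ω (d * s) : ZMod N → ℂ)
      = ∑ t : ZMod N, zpw ω (t * d) • fun s => if s = t then (1 : ℂ) else 0 := by
    funext s
    simp [Finset.sum_apply, mul_comm d]
  change ofFunₗ N _ = ∑ t : ZMod N, zpw ω (t * d) • ofFunₗ N _
  rw [h, map_sum]
  simp only [map_smul]

theorem linearMap_ext (hω : IsPrimitiveRoot ω N) {M : Type*} [AddCommGroup M] [Module ℂ M]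
    {S T : (ZMod N → ℂ) →ₗ[ℂ] M}
    (h : ∀ d : ZMod N, S (fun s => zpw ω (d * s)) = T fun s => zpw ω (d * s)) : S = T := by
  refine LinearMap.ext fun f => ?_
  rw [fun_eq_sum_zpw hω f, map_sum, map_sum]
  simp only [map_smul, h]

theorem mem_of_char_mem (hω : IsPrimitiveRoot ω N) (C : Submodule ℂ (CZ N).A)
    (h : ∀ d : ZMod N, char ω d ∈ C) (x : (CZ N).A) : x ∈ C := by
  obtain ⟨_, f, rfl⟩ := x
  change ofFunₗ N f ∈ C
  rw [fun_eq_sum_zpw hω f, map_sum]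
  refine sum_mem fun d _ => ?_
  rw [map_smul]
  exact C.smul_mem _ (h d)

end CZ

/-! ### The homomorphism `id ⊠ f` -/

theorem exists_starAlgHom_of_le_range {A B C : Type*} [Ring A] [StarRing A] [Algebra ℂ A] [Ring B]
    [StarRing B] [Algebra ℂ B] [StarModule ℂ B] [Ring C] [StarRing C] [Algebra ℂ C]
    {g : A →⋆ₐ[ℂ] B} (hg : Function.Injective g) {S : StarSubalgebra ℂ B} (hS : S ≤ g.range)
    (g' : A →⋆ₐ[ℂ] C) : ∃ Φ : S →⋆ₐ[ℂ] C, ∀ (s : S) (a : A), g a = s → Φ s = g' a := by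
  let e : A ≃⋆ₐ[ℂ] g.range := StarAlgEquiv.ofInjective g hg
  refine ⟨(g'.comp (e.symm : g.range →⋆ₐ[ℂ] A)).comp (StarSubalgebra.inclusion hS),
    fun s a ha => congrArg g' ((StarAlgEquiv.symm_apply_eq e).mpr (Subtype.ext ha.symm))⟩

theorem IsDecomposition.matrixRep_inner {ι A G K : Type*} [Fintype ι] [DecidableEq ι] [Ring A]
    [StarRing A] [Algebra ℂ A] [NormedAddCommGroup G] [InnerProductSpace ℂ G]
    [NormedAddCommGroup K] [InnerProductSpace ℂ K] [CompleteSpace K]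
    (b : OrthonormalBasis ι ℂ G) (f : A →⋆ₐ[ℂ] (K →L[ℂ] K)) (x : G →L[ℂ] G) :
    (isDecomposition_ket b).matrixRep f
      (Matrix.of fun i j => algebraMap ℂ A (inner ℂ (b i) (x (b j)))) = opTensor x 1 := by
  refine (isDecomposition_ket b).matrixRep_eq f fun j => ContinuousLinearMap.ext fun v => ?_
  change opTensor x 1 (HTensor.tmul (b j) v) = _
  simp only [Matrix.of_apply, AlgHomClass.commutes]
  rw [opTensor_tmul, ← b.sum_repr' (x (b j)), HTensor.sum_tmul]
  simp only [b.sum_repr', Algebra.algebraMap_eq_smul_one, sum_apply, smul_apply, ket_apply,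
    ContinuousLinearMap.comp_apply, HTensor.smul_tmul, HTensor.tmul_smul, one_apply_eq_self]

namespace ZNAlg

variable {N : ℕ} [NeZero N] {ω : ℂ} {X : ZNAlg.{u} N} {Y : ZNAlg.{v} N}

section Eigenvector

variable {n : ZMod N} {ξ : X.H}

theorem proj_apply_of_eigenvector (hω : IsPrimitiveRoot ω N)
    (hξ : ∀ t, X.V t ξ = zpw ω (t * n) • ξ) (m : ZMod N) :
    X.proj ω m ξ = if m = n then ξ else 0 := by
  simp only [proj_eq, smul_apply, sum_apply, hξ, smul_smul, ← zpw_add hω, neg_add_eq_sub,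
    ← mul_sub]
  rw [← Finset.sum_smul, sum_zpw_mul_right hω]
  simp only [sub_eq_zero, eq_comm (a := n)]
  split_ifs
  · rw [smul_smul, inv_mul_cancel₀ (NeZero.ne _), one_smul]
  · rw [zero_smul, smul_zero]

theorem blockDiag_comp_ket {K : Type*} [NormedAddCommGroup K] [InnerProductSpace ℂ K]
    (hω : IsPrimitiveRoot ω N) (hξ : ∀ t, X.V t ξ = zpw ω (t * n) • ξ) (f : ZMod N → K →L[ℂ] K) :
    X.blockDiag ω f ∘L ket K ξ = ket K ξ ∘L f n := by
  refine ContinuousLinearMap.ext fun v => ?_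
  change (∑ m, opTensor (X.proj ω m) (f m)) (HTensor.tmul ξ v) = HTensor.tmul ξ (f n v)
  simp only [sum_apply, opTensor_tmul, proj_apply_of_eigenvector hω hξ]
  rw [Finset.sum_eq_single n (fun m _ hm => ?_) (by simp), if_pos rfl]
  rw [if_neg hm]
  exact (congrArg (HTensor.incl _ _) (TensorProduct.zero_tmul _ _)).trans (map_zero _)

theorem opj₂_comp_ket (hω : IsPrimitiveRoot ω N) (hξ : ∀ t, X.V t ξ = zpw ω (t * n) • ξ)
    (y : Y.H →L[ℂ] Y.H) :
    opj₂ ω X Y y ∘L ket Y.H ξ = ket Y.H ξ ∘L (Y.V (-n) * y * Y.V n) := by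
  rw [opj₂_eq X Y hω, blockDiag_comp_ket hω hξ]

end Eigenvector

theorem matrixRep_diagonal_act (hω : IsPrimitiveRoot ω N) (f : X.A →⋆ₐ[ℂ] Y.A)
    (hf : ∀ t a, f (X.act t a) = Y.act t (f a)) (a : X.A) :
    (isDecomposition_ket (chiBasis hω)).matrixRep (Y.A.subtype.comp f)
      (Matrix.diagonal fun m => X.act (-m) a) = opj₂ ω (CZ N) Y (f a) := by
  refine (isDecomposition_ket (chiBasis hω)).matrixRep_eq _ fun j => ?_
  rw [opj₂_comp_ket hω (V_chiBasis hω j), Finset.sum_eq_single j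
    (fun i _ hij => by rw [Matrix.diagonal_apply_ne _ hij, map_zero,
      ContinuousLinearMap.comp_zero]) (by simp), Matrix.diagonal_apply_eq]
  congr 1
  change _ = ((f (X.act (-j) a) : Y.A) : Y.H →L[ℂ] Y.H)
  rw [hf, coe_act, neg_neg]

theorem box_le_range_matrixRep (hω : IsPrimitiveRoot ω N) :
    (box ω (CZ N) X).A ≤ ((isDecomposition_ket (chiBasis hω)).matrixRep X.A.subtype).range := by
  intro a ha
  have hclosed : IsClosed (Set.range X.A.subtype) := by
    have h := X.isClosed
    rwa [← Subtype.range_coe (s := (X.A : Set (X.H →L[ℂ] X.H)))] at h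
  refine box_mem (φ := (box ω (CZ N) X).A.subtype)
    (C := ((isDecomposition_ket (chiBasis hω)).matrixRep X.A.subtype).range)
    ?_ (fun x => ⟨_, IsDecomposition.matrixRep_inner (chiBasis hω) _ x⟩)
    (fun y => ⟨_, matrixRep_diagonal_act hω (StarAlgHom.id ℂ X.A) (fun _ _ => rfl) y⟩) ⟨a, ha⟩
  exact (isDecomposition_ket (chiBasis hω)).isClosed_range_matrixRep _ hclosed

theorem exists_id_box (hω : IsPrimitiveRoot ω N) (f : X.A →⋆ₐ[ℂ] Y.A)
    (hf : ∀ t a, f (X.act t a) = Y.act t (f a)) :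
    ∃ Φ : (box ω (CZ N) X).A →⋆ₐ[ℂ] (box ω (CZ N) Y).A,
      (∀ x, Φ (j₁ ω (CZ N) X x) = j₁ ω (CZ N) Y x) ∧
      ∀ a, Φ (j₂ ω (CZ N) X a) = j₂ ω (CZ N) Y (f a) := by
  obtain ⟨Φ₀, hΦ₀⟩ := exists_starAlgHom_of_le_range
    ((isDecomposition_ket (chiBasis hω)).matrixRep_injective _ Subtype.val_injective)
    (box_le_range_matrixRep (X := X) hω)
    ((isDecomposition_ket (chiBasis hω)).matrixRep (Y.A.subtype.comp f))
  have h₁ (x : (CZ N).A) : Φ₀ (j₁ ω (CZ N) X x) = opj₁ (CZ N) Y x :=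
    (hΦ₀ _ _ (IsDecomposition.matrixRep_inner (chiBasis hω) _ x)).trans
      (IsDecomposition.matrixRep_inner (chiBasis hω) _ x)
  have h₂ (a : X.A) : Φ₀ (j₂ ω (CZ N) X a) = opj₂ ω (CZ N) Y (f a) :=
    (hΦ₀ _ _ (matrixRep_diagonal_act hω (StarAlgHom.id ℂ X.A) (fun _ _ => rfl) a)).trans
      (matrixRep_diagonal_act hω f hf a)
  have hmem : ∀ a, Φ₀ a ∈ (box ω (CZ N) Y).A :=
    box_mem (box ω (CZ N) Y).isClosed Φ₀
      (fun x => (h₁ x).symm ▸ opj₁_mem ω (CZ N) Y x.2)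
      (fun a => (h₂ a).symm ▸ opj₂_mem ω (CZ N) Y (f a).2)
  exact ⟨StarAlgHom.codRestrict Φ₀ _ hmem, fun x => Subtype.ext (h₁ x), fun a => Subtype.ext (h₂ a)⟩

end ZNAlg

/-! ### The homomorphism `ψ` -/

section MinTensor

variable {H K : Type*} [NormedAddCommGroup H] [InnerProductSpace ℂ H] [CompleteSpace H]
  [NormedAddCommGroup K] [InnerProductSpace ℂ K] [CompleteSpace K]

/-- Elementary tensors as a bilinear map. -/
def minTensor.tmulₗ (A : StarSubalgebra ℂ (H →L[ℂ] H)) (B : StarSubalgebra ℂ (K →L[ℂ] K)) :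
    A →ₗ[ℂ] B →ₗ[ℂ] minTensor A B :=
  LinearMap.mk₂ ℂ minTensor.tmul
    (fun _ _ _ => Subtype.ext (opTensor_add_left _ _ _))
    (fun _ _ _ => Subtype.ext (opTensor_smul_left _ _ _))
    (fun _ _ _ => Subtype.ext (opTensor_add_right _ _ _))
    (fun _ _ _ => Subtype.ext (opTensor_smul_right _ _ _))

variable {A : StarSubalgebra ℂ (H →L[ℂ] H)} {B : StarSubalgebra ℂ (K →L[ℂ] K)}

theorem minTensor.tmul_eq (a : A) (b : B) :
    minTensor.tmul a b = minTensor.tmulₗ A B a b := rfl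

theorem minTensor.smul_tmul (c : ℂ) (a : A) (b : B) :
    minTensor.tmul (c • a) b = minTensor.tmul a (c • b) := by
  simp only [minTensor.tmul_eq, map_smul, LinearMap.smul_apply]

theorem minTensor.tmul_zero (a : A) : minTensor.tmul a (0 : B) = 0 :=
  (minTensor.tmulₗ A B a).map_zero

theorem minTensor.tmul_sum {ι : Type*} (s : Finset ι) (a : A) (b : ι → B) :
    minTensor.tmul a (∑ i ∈ s, b i) = ∑ i ∈ s, minTensor.tmul a (b i) :=
  map_sum (minTensor.tmulₗ A B a) b s

theorem minTensor.sum_tmul {ι : Type*} (s : Finset ι) (a : ι → A) (b : B) :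
    minTensor.tmul (∑ i ∈ s, a i) b = ∑ i ∈ s, minTensor.tmul (a i) b :=
  LinearMap.map_sum₂ (minTensor.tmulₗ A B) s a b

theorem minTensor.zero_tmul (b : B) : minTensor.tmul (0 : A) b = 0 :=
  LinearMap.map_zero₂ (minTensor.tmulₗ A B) b

theorem minTensor.tmul_mul_tmul (a a' : A) (b b' : B) :
    minTensor.tmul a b * minTensor.tmul a' b' = minTensor.tmul (a * a') (b * b') :=
  Subtype.ext (opTensor_mul _ _ _ _)

theorem minTensor.isClosed (A : StarSubalgebra ℂ (H →L[ℂ] H)) (B : StarSubalgebra ℂ (K →L[ℂ] K)) :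
    IsClosed (minTensor A B : Set (HTensor H K →L[ℂ] HTensor H K)) :=
  StarSubalgebra.isClosed_topologicalClosure _

end MinTensor

namespace ZNAlg

open ContinuousLinearMap (adjoint)

variable {N : ℕ} [NeZero N] {ω : ℂ} (X : ZNAlg.{u} N) (Y : ZNAlg.{v} N)

/-- The unitary that acts on the second factor as the `n`-th power of `z` when the first factor has
weight `n`; conjugation by it produces the coactions in the definition of `ψ`. -/
def coactionOp (ω : ℂ) : HTensor (box ω (CZ N) X).H (box ω (CZ N) Y).H →L[ℂ]
    HTensor (box ω (CZ N) X).H (box ω (CZ N) Y).H :=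
  (box ω (CZ N) X).blockDiag ω fun n => (j₁ ω (CZ N) Y (CZ.char ω n)).1

theorem coactionOp_mem_unitary (hω : IsPrimitiveRoot ω N) : coactionOp X Y ω ∈ unitary _ := by
  have hchar (n : ZMod N) : CZ.char ω n ∈ unitary (CZ N).A := by
    rw [Unitary.mem_iff, CZ.star_char hω, ← CZ.char_add hω, ← CZ.char_add hω, neg_add_cancel,
      add_neg_cancel, CZ.char_zero]
    exact ⟨rfl, rfl⟩
  have hj (n : ZMod N) := Unitary.map_mem
    ((box ω (CZ N) Y).A.subtype.comp (j₁Hom (CZ N) Y ω)) (hchar n)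
  exact Unitary.map_mem ((box ω (CZ N) X).blockDiagHom hω)
    (Unitary.mem_iff.mpr ⟨funext fun n => (hj n).1, funext fun n => (hj n).2⟩)

variable {X Y}

theorem opTensor_mul_coactionOp_of_left (hω : IsPrimitiveRoot ω N) {x : (box ω (CZ N) X).A}
    {d : ZMod N} (hx : IsHomogeneous ω x d) :
    opTensor x.1 (j₁ ω (CZ N) Y (CZ.char ω d)).1 * coactionOp X Y ω =
      coactionOp X Y ω * opTensor x.1 1 := by
  rw [coactionOp, blockDiag_mul_opTensor hω hx]
  have h : (fun m => (j₁ ω (CZ N) Y (CZ.char ω (m + d))).1) =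
      (fun _ => (j₁ ω (CZ N) Y (CZ.char ω d)).1) * fun m => (j₁ ω (CZ N) Y (CZ.char ω m)).1 := by
    funext m
    rw [add_comm, CZ.char_add hω, ← j₁Hom_apply, map_mul]
    rfl
  rw [h, ← blockDiagHom_apply _ hω, ← blockDiagHom_apply _ hω, map_mul, blockDiagHom_apply,
    blockDiagHom_apply, blockDiag_const _ hω, ← mul_assoc, opTensor_mul, mul_one, one_mul]

theorem opTensor_mul_coactionOp_of_right (hω : IsPrimitiveRoot ω N) {b : Y.A}
    {e : ZMod N} (hb : IsHomogeneous ω b e) :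
    opTensor 1 (j₂ ω (CZ N) Y b).1 * coactionOp X Y ω =
      coactionOp X Y ω * opTensor ((box ω (CZ N) X).V (-e)) (j₂ ω (CZ N) Y b).1 := by
  rw [coactionOp, ← blockDiag_const _ hω, ← blockDiag_zpw_smul _ hω]
  simp only [← blockDiagHom_apply _ hω]
  rw [← map_mul, ← map_mul]
  refine congrArg _ (funext fun n => ?_)
  have h := congrArg Subtype.val (j₂_mul_j₁ (Y := Y) hω (CZ.isHomogeneous_char hω n) hb)
  rw [← neg_mul, ← mul_smul_comm] at h
  exact h

variable (X Y)

theorem isDecomposition_ket_comp_V_comp_assocOp (hω : IsPrimitiveRoot ω N) :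
    IsDecomposition fun k : ZMod N =>
      opTensor (1 : HTensor (CZ N).H X.H →L[ℂ] HTensor (CZ N).H X.H)
        (ket Y.H (chiBasis hω k) ∘L Y.V (-k)) ∘L assocOp (chiBasis hω) X.H Y.H := by
  have hV (k : ZMod N) := (Y.U (Multiplicative.ofAdd (-k))).2
  have hket := (isDecomposition_ket (K := Y.H) (chiBasis hω)).comp_right
    (fun k => (hV k).1) (fun k => (hV k).2)
  exact (hket.opTensor_one_left (HTensor (CZ N).H X.H)).comp_right
    (fun _ => adjoint_assocOp_comp_assocOp (chiBasis hω) X.H Y.H)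
    (fun _ => assocOp_comp_adjoint_assocOp (chiBasis hω) X.H Y.H)

/-- The homomorphism `x ⊗ a ⊗ b ↦ (x ⊗ a) ⊗ j₂ b`; twisting it by `coactionOp` gives `ψ`. -/
def tensorj₂Hom (hω : IsPrimitiveRoot ω N) :
    (HTensor (CZ N).H (HTensor X.H Y.H) →L[ℂ] HTensor (CZ N).H (HTensor X.H Y.H)) →⋆ₐ[ℂ]
      (HTensor (box ω (CZ N) X).H (box ω (CZ N) Y).H →L[ℂ]
        HTensor (box ω (CZ N) X).H (box ω (CZ N) Y).H) :=
  (isDecomposition_ket_comp_V_comp_assocOp X Y hω).amplHom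

theorem tensorj₂Hom_apply (hω : IsPrimitiveRoot ω N) (x : (CZ N).H →L[ℂ] (CZ N).H)
    (a : X.H →L[ℂ] X.H) (b : Y.H →L[ℂ] Y.H) :
    tensorj₂Hom X Y hω (opTensor x (opTensor a b)) =
      opTensor (opTensor x a) (opj₂ ω (CZ N) Y b) := by
  refine (isDecomposition_ket_comp_V_comp_assocOp X Y hω).amplHom_eq fun k => ?_
  have hket : opj₂ ω (CZ N) Y b ∘L (ket Y.H (chiBasis hω k) ∘L Y.V (-k)) =
      (ket Y.H (chiBasis hω k) ∘L Y.V (-k)) ∘L b := by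
    rw [← ContinuousLinearMap.comp_assoc, opj₂_comp_ket hω (V_chiBasis hω k),
      ContinuousLinearMap.comp_assoc, ContinuousLinearMap.comp_assoc]
    change _ ∘L (Y.V (-k) * b * Y.V k * Y.V (-k)) = _
    rw [mul_assoc _ (Y.V k), V_mul, add_neg_cancel, V_zero, mul_one]
    rfl
  rw [ContinuousLinearMap.comp_assoc, assocOp_comp_opTensor, ← ContinuousLinearMap.comp_assoc,
    ← ContinuousLinearMap.comp_assoc, opTensor_comp, opTensor_comp, ← hket,
    ContinuousLinearMap.one_def, ContinuousLinearMap.id_comp, ContinuousLinearMap.comp_id]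

/-- The homomorphism `ψ` on the level of operators. -/
def opψ (hω : IsPrimitiveRoot ω N) :
    ((box ω (CZ N) (box ω X Y)).H →L[ℂ] (box ω (CZ N) (box ω X Y)).H) →⋆ₐ[ℂ]
      (HTensor (box ω (CZ N) X).H (box ω (CZ N) Y).H →L[ℂ]
        HTensor (box ω (CZ N) X).H (box ω (CZ N) Y).H) :=
  (StarAlgEquiv.toStarAlgHom (Unitary.conjStarAlgAut ℂ _
    ⟨coactionOp X Y ω, coactionOp_mem_unitary X Y hω⟩)).comp (tensorj₂Hom X Y hω)

theorem opψ_eq (hω : IsPrimitiveRoot ω N)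
    {T : (box ω (CZ N) (box ω X Y)).H →L[ℂ] (box ω (CZ N) (box ω X Y)).H}
    {G : HTensor (box ω (CZ N) X).H (box ω (CZ N) Y).H →L[ℂ]
      HTensor (box ω (CZ N) X).H (box ω (CZ N) Y).H}
    (hG : G * coactionOp X Y ω = coactionOp X Y ω * tensorj₂Hom X Y hω T) :
    opψ X Y hω T = G := by
  change coactionOp X Y ω * tensorj₂Hom X Y hω T * star (coactionOp X Y ω) = G
  rw [← hG, mul_assoc, (coactionOp_mem_unitary X Y hω).2, mul_one]

theorem opψ_j₁_char (hω : IsPrimitiveRoot ω N) (d : ZMod N) :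
    opψ X Y hω (j₁ ω (CZ N) (box ω X Y) (CZ.char ω d)).1 =
      (minTensor.tmul (j₁ ω (CZ N) X (CZ.char ω d)) (j₁ ω (CZ N) Y (CZ.char ω d))).1 := by
  have h : tensorj₂Hom X Y hω (j₁ ω (CZ N) (box ω X Y) (CZ.char ω d)).1 =
      opTensor (j₁ ω (CZ N) X (CZ.char ω d)).1 (1 : (box ω (CZ N) Y).H →L[ℂ] _) := by
    refine (congrArg (fun S => tensorj₂Hom X Y hω (opTensor _ S)) opTensor_one.symm).trans ?_
    refine (tensorj₂Hom_apply X Y hω _ 1 1).trans ?_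
    exact congrArg (opTensor _) (map_one (opj₂Hom (CZ N) Y hω))
  refine opψ_eq X Y hω ?_
  rw [h]
  exact opTensor_mul_coactionOp_of_left hω (CZ.isHomogeneous_char hω d).j₁

variable {X Y}

theorem opψ_j₂_j₁_of_isHomogeneous (hω : IsPrimitiveRoot ω N) {a : X.A} {d : ZMod N}
    (ha : IsHomogeneous ω a d) :
    opψ X Y hω (j₂ ω (CZ N) (box ω X Y) (j₁ ω X Y a)).1 =
      (minTensor.tmul (j₂ ω (CZ N) X a) (j₁ ω (CZ N) Y (CZ.char ω d))).1 := by
  have h : tensorj₂Hom X Y hω (j₂ ω (CZ N) (box ω X Y) (j₁ ω X Y a)).1 =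
      opTensor (j₂ ω (CZ N) X a).1 (1 : (box ω (CZ N) Y).H →L[ℂ] _) := by
    refine (congrArg _ (opj₂_of_isHomogeneous hω ha.j₁)).trans ?_
    refine (tensorj₂Hom_apply X Y hω _ _ 1).trans ?_
    exact congrArg₂ opTensor (opj₂_of_isHomogeneous hω ha).symm
      (map_one (opj₂Hom (CZ N) Y hω))
  refine opψ_eq X Y hω ?_
  rw [h]
  exact opTensor_mul_coactionOp_of_left hω (ha.j₂ hω)

theorem opψ_j₂_j₂_of_isHomogeneous (hω : IsPrimitiveRoot ω N) {b : Y.A} {e : ZMod N}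
    (hb : IsHomogeneous ω b e) :
    opψ X Y hω (j₂ ω (CZ N) (box ω X Y) (j₂ ω X Y b)).1 =
      (minTensor.tmul (1 : (box ω (CZ N) X).A) (j₂ ω (CZ N) Y b)).1 := by
  have h : tensorj₂Hom X Y hω (j₂ ω (CZ N) (box ω X Y) (j₂ ω X Y b)).1 =
      opTensor ((box ω (CZ N) X).V (-e)) (j₂ ω (CZ N) Y b).1 := by
    refine (congrArg _ (opj₂_of_isHomogeneous hω (hb.j₂ hω))).trans ?_
    refine (congrArg (fun S => tensorj₂Hom X Y hω (opTensor _ S))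
      (opj₂_of_isHomogeneous hω hb)).trans ?_
    exact tensorj₂Hom_apply X Y hω _ _ _
  refine opψ_eq X Y hω ?_
  rw [h]
  exact opTensor_mul_coactionOp_of_right hω hb

theorem sum_tmul_act_delta (hω : IsPrimitiveRoot ω N) {a : X.A} {d : ZMod N}
    (ha : IsHomogeneous ω a d) :
    ∑ t, minTensor.tmul (j₂ ω (CZ N) X (X.act t a)) (j₁ ω (CZ N) Y (CZ.delta N t)) =
      minTensor.tmul (j₂ ω (CZ N) X a) (j₁ ω (CZ N) Y (CZ.char ω d)) := by
  rw [CZ.char_eq_sum_delta, ← j₁Hom_apply, map_sum, minTensor.tmul_sum]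
  refine Finset.sum_congr rfl fun t _ => ?_
  rw [ha t, ← j₂Hom_apply _ _ hω, map_smul, map_smul, minTensor.smul_tmul]
  rfl

variable (X Y)

theorem tmul_j₁_char (hω : IsPrimitiveRoot ω N) (d : ZMod N) :
    minTensor.tmul (j₁ ω (CZ N) X (CZ.char ω d)) (j₁ ω (CZ N) Y (CZ.char ω d)) =
      ∑ s, ∑ t, zpw ω (d * (s + t)) • minTensor.tmul (j₁ ω (CZ N) X (CZ.delta N s))
        (j₁ ω (CZ N) Y (CZ.delta N t)) := by
  simp only [← j₁Hom_apply, CZ.char_eq_sum_delta, minTensor.tmul_eq, map_sum, map_smul,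
    LinearMap.sum_apply, LinearMap.smul_apply]
  simp only [Finset.smul_sum, smul_smul, ← zpw_add hω]
  rw [Finset.sum_comm]
  refine Finset.sum_congr rfl fun s _ => Finset.sum_congr rfl fun t _ => ?_
  congr 2
  ring

theorem opψ_j₁ (hω : IsPrimitiveRoot ω N) (f : ZMod N → ℂ) :
    opψ X Y hω (j₁ ω (CZ N) (box ω X Y) (CZ.ofFun N f)).1 =
      (∑ s, ∑ t, f (s + t) • minTensor.tmul (j₁ ω (CZ N) X (CZ.delta N s))
        (j₁ ω (CZ N) Y (CZ.delta N t))).1 := by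
  let T := minTensor (box ω (CZ N) X).A (box ω (CZ N) Y).A
  let W : (ZMod N → ℂ) →ₗ[ℂ] T := ∑ s, ∑ t, (LinearMap.proj (s + t)).smulRight
    (minTensor.tmul (j₁ ω (CZ N) X (CZ.delta N s)) (j₁ ω (CZ N) Y (CZ.delta N t)))
  have hW (f : ZMod N → ℂ) : W f = ∑ s, ∑ t, f (s + t) •
      minTensor.tmul (j₁ ω (CZ N) X (CZ.delta N s)) (j₁ ω (CZ N) Y (CZ.delta N t)) := by
    simp only [W, LinearMap.sum_apply, LinearMap.smulRight_apply, LinearMap.proj_apply]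
  rw [← hW]
  let ψ₁ : (ZMod N → ℂ) →ₗ[ℂ] (HTensor (box ω (CZ N) X).H (box ω (CZ N) Y).H →L[ℂ]
      HTensor (box ω (CZ N) X).H (box ω (CZ N) Y).H) :=
    ((opψ X Y hω).comp ((box ω (CZ N) (box ω X Y)).A.subtype.comp
      (j₁Hom (CZ N) (box ω X Y) ω))).toAlgHom.toLinearMap ∘ₗ CZ.ofFunₗ N
  have h : ψ₁ = T.subtype.toAlgHom.toLinearMap ∘ₗ W := CZ.linearMap_ext hω fun d => by
    have hd := (tmul_j₁_char X Y hω d).trans (hW fun s => zpw ω (d * s)).symm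
    exact (opψ_j₁_char X Y hω d).trans (congrArg T.subtype hd)
  exact LinearMap.congr_fun h f

theorem opψ_j₂_j₁ (hω : IsPrimitiveRoot ω N) (a : X.A) :
    opψ X Y hω (j₂ ω (CZ N) (box ω X Y) (j₁ ω X Y a)).1 =
      (∑ t, minTensor.tmul (j₂ ω (CZ N) X (X.act t a)) (j₁ ω (CZ N) Y (CZ.delta N t))).1 := by
  let T := minTensor (box ω (CZ N) X).A (box ω (CZ N) Y).A
  let ψ₂ := (opψ X Y hω).comp ((box ω (CZ N) (box ω X Y)).A.subtype.comp
    ((j₂Hom (CZ N) (box ω X Y) hω).comp (j₁Hom X Y ω)))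
  obtain ⟨c, hc, rfl⟩ := X.exists_sum_isHomogeneous hω a
  have h (t : ZMod N) : minTensor.tmul (j₂ ω (CZ N) X (X.act t (∑ d, c d)))
      (j₁ ω (CZ N) Y (CZ.delta N t)) = ∑ d, minTensor.tmul (j₂ ω (CZ N) X (X.act t (c d)))
      (j₁ ω (CZ N) Y (CZ.delta N t)) := by
    simp only [← actHom_apply, ← j₂Hom_apply _ _ hω, map_sum, minTensor.sum_tmul]
  simp only [h]
  rw [Finset.sum_comm]
  refine (map_sum ψ₂ c _).trans (Eq.trans ?_ (map_sum T.subtype _ _).symm)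
  refine Finset.sum_congr rfl fun d _ => ?_
  rw [sum_tmul_act_delta hω (hc d)]
  exact opψ_j₂_j₁_of_isHomogeneous hω (hc d)

theorem opψ_j₂_j₂ (hω : IsPrimitiveRoot ω N) (b : Y.A) :
    opψ X Y hω (j₂ ω (CZ N) (box ω X Y) (j₂ ω X Y b)).1 =
      (minTensor.tmul (1 : (box ω (CZ N) X).A) (j₂ ω (CZ N) Y b)).1 := by
  let T := minTensor (box ω (CZ N) X).A (box ω (CZ N) Y).A
  let ψ₃ := (opψ X Y hω).comp ((box ω (CZ N) (box ω X Y)).A.subtype.comp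
    ((j₂Hom (CZ N) (box ω X Y) hω).comp (j₂Hom X Y hω)))
  obtain ⟨c, hc, rfl⟩ := Y.exists_sum_isHomogeneous hω b
  rw [← j₂Hom_apply (CZ N) Y hω, map_sum, minTensor.tmul_sum]
  refine (map_sum ψ₃ c _).trans (Eq.trans ?_ (map_sum T.subtype _ _).symm)
  exact Finset.sum_congr rfl fun e _ => opψ_j₂_j₂_of_isHomogeneous hω (hc e)

theorem exists_psi (hω : IsPrimitiveRoot ω N) :
    ∃ ψ : (box ω (CZ N) (box ω X Y)).A →⋆ₐ[ℂ] minTensor (box ω (CZ N) X).A (box ω (CZ N) Y).A,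
      (∀ f : ZMod N → ℂ, ψ (j₁ ω (CZ N) (box ω X Y) (CZ.ofFun N f)) =
        ∑ s, ∑ t, f (s + t) • minTensor.tmul (j₁ ω (CZ N) X (CZ.delta N s))
          (j₁ ω (CZ N) Y (CZ.delta N t))) ∧
      (∀ a : X.A, ψ (j₂ ω (CZ N) (box ω X Y) (j₁ ω X Y a)) =
        ∑ t, minTensor.tmul (j₂ ω (CZ N) X (X.act t a)) (j₁ ω (CZ N) Y (CZ.delta N t))) ∧
      ∀ b : Y.A, ψ (j₂ ω (CZ N) (box ω X Y) (j₂ ω X Y b)) =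
        minTensor.tmul 1 (j₂ ω (CZ N) Y b) := by
  let T := minTensor (box ω (CZ N) X).A (box ω (CZ N) Y).A
  have hT := minTensor.isClosed (box ω (CZ N) X).A (box ω (CZ N) Y).A
  let ψ₀ := (opψ X Y hω).comp (box ω (CZ N) (box ω X Y)).A.subtype
  have hmem : ∀ a, ψ₀ a ∈ T := by
    refine box_mem hT ψ₀ ?_ fun y => ?_
    · rintro ⟨_, f, rfl⟩
      exact (opψ_j₁ X Y hω f).symm ▸ Subtype.property _
    · refine box_mem hT (ψ₀.comp (j₂Hom (CZ N) (box ω X Y) hω)) (fun a => ?_) (fun b => ?_) y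
      · exact (opψ_j₂_j₁ X Y hω a).symm ▸ Subtype.property _
      · exact (opψ_j₂_j₂ X Y hω b).symm ▸ Subtype.property _
  exact ⟨StarAlgHom.codRestrict ψ₀ T hmem, fun f => Subtype.ext (opψ_j₁ X Y hω f),
    fun a => Subtype.ext (opψ_j₂_j₁ X Y hω a), fun b => Subtype.ext (opψ_j₂_j₂ X Y hω b)⟩

end ZNAlg

/-! ### The comultiplication of the bosonization -/

namespace EquivariantRep

variable {N : ℕ} [NeZero N] {ω : ℂ} (L : EquivariantRep.{u} N ω)

theorem exists_isBosonComult (hω : IsPrimitiveRoot ω N) :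
    ∃ D : L.boson.A →⋆ₐ[ℂ] minTensor L.boson.A L.boson.A, L.IsBosonComult D := by
  obtain ⟨Δ, hΔ⟩ := L.exists_isBraidedComult hω
  obtain ⟨Φ, hΦ₁, hΦ₂⟩ := ZNAlg.exists_id_box (X := L.alg) (Y := L.double) hω
    (Δ.comp (L.opEquiv.symm : L.alg.A →⋆ₐ[ℂ] CS N ω)) (hΔ.map_act L hω)
  obtain ⟨ψ, hψ₁, hψ₂, hψ₃⟩ := ZNAlg.exists_psi L.alg L.alg hω
  refine ⟨ψ.comp Φ, Δ, Φ, ψ, hΔ, fun x a => ?_, ⟨hψ₁, hψ₂, hψ₃⟩, rfl⟩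
  rw [map_mul, hΦ₁, hΦ₂]
  change _ * ZNAlg.j₂ ω (CZ N) L.double (Δ (L.opEquiv.symm (L.opEquiv a))) = _
  rw [StarAlgEquiv.symm_apply_apply]

theorem op_one : L.op 1 = 1 := map_one L.opEquiv

/-- The element `j₁(z ^ d)` of the bosonization. -/
def zPow (d : ZMod N) : L.boson.A := ZNAlg.j₁ ω (CZ N) L.alg (CZ.char ω d)

/-- The element `j₂(q i j)` of the bosonization. -/
def j₂q (i j : ZMod N) : L.boson.A := ZNAlg.j₂ ω (CZ N) L.alg (L.op (q ω i j))

variable {L}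

theorem zPow_zero : L.zPow 0 = 1 := by
  rw [zPow, CZ.char_zero, ← ZNAlg.j₁Hom_apply, map_one]

theorem zPow_mul (hω : IsPrimitiveRoot ω N) (d e : ZMod N) :
    L.zPow d * L.zPow e = L.zPow (d + e) := by
  simp only [zPow, CZ.char_add hω, ← ZNAlg.j₁Hom_apply, map_mul]

theorem star_zPow (hω : IsPrimitiveRoot ω N) (d : ZMod N) : star (L.zPow d) = L.zPow (-d) := by
  simp only [zPow, ← CZ.star_char hω, ← ZNAlg.j₁Hom_apply, map_star]

theorem zPow_eq_pow (hω : IsPrimitiveRoot ω N) (d : ZMod N) : L.zPow d = L.z ^ d.val := by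
  simp only [zPow, z, CZ.char_eq_pow hω, ← ZNAlg.j₁Hom_apply, map_pow]

theorem zPow_one : L.zPow 1 = L.z := by
  simp only [z, zPow, CZ.char, one_mul]
  rfl

theorem anyonicFamily_j₂q (hω : IsPrimitiveRoot ω N) : AnyonicFamily ω L.j₂q :=
  L.anyonicFamily_op.map (ZNAlg.j₂Hom (CZ N) L.alg hω)

theorem j₂q_mul_zPow (hω : IsPrimitiveRoot ω N) (i j d : ZMod N) :
    L.j₂q i j * L.zPow d = zpw ω (-((j - i) * d)) • (L.zPow d * L.j₂q i j) :=
  ZNAlg.j₂_mul_j₁ hω (CZ.isHomogeneous_char hω d) (L.isHomogeneous_op i j)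

theorem t_eq_zPow_mul_j₂q (hω : IsPrimitiveRoot ω N) (i j : ZMod N) :
    L.t i j = L.zPow i * L.j₂q i j := by
  rw [t, zPow, CZ.char_eq_pow hω, j₂q]

theorem mem_of_zPow_mem_of_j₂q_mem (hω : IsPrimitiveRoot ω N) {C : StarSubalgebra ℂ L.boson.A}
    (hC : IsClosed (C : Set L.boson.A)) (hz : ∀ d, L.zPow d ∈ C) (hq : ∀ i j, L.j₂q i j ∈ C)
    (a : L.boson.A) : a ∈ C := by
  have : IsClosed (L.boson.A : Set (L.boson.H →L[ℂ] L.boson.H)) := L.boson.isClosed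
  refine ZNAlg.box_mem (B := L.boson.A) hC (StarAlgHom.id ℂ L.boson.A) (fun x => ?_)
    (fun y => ?_) a
  · exact CZ.mem_of_char_mem hω (C.toSubalgebra.toSubmodule.comap
      (ZNAlg.j₁Hom (CZ N) L.alg ω).toAlgHom.toLinearMap) hz x
  · obtain ⟨b, rfl⟩ := L.op_surjective y
    let ι : CS N ω →⋆ₐ[ℂ] L.boson.A :=
      (ZNAlg.j₂Hom (CZ N) L.alg hω).comp (L.opEquiv : CS N ω →⋆ₐ[ℂ] L.alg.A)
    exact CS.induction (C.comap ι) (hC.preimage (continuous_starAlgHom ι)) hq b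

section Comult

variable {Δ : CS N ω →⋆ₐ[ℂ] L.double.A} {Φ : L.boson.A →⋆ₐ[ℂ] L.triple.A}

theorem IsIdBoxComult.apply_j₁ (hω : IsPrimitiveRoot ω N) (h : L.IsIdBoxComult Δ Φ)
    (x : (CZ N).A) : Φ (ZNAlg.j₁ ω (CZ N) L.alg x) = ZNAlg.j₁ ω (CZ N) L.double x := by
  have := h x 1
  rwa [op_one, map_one, ← ZNAlg.j₂Hom_apply _ _ hω, ← ZNAlg.j₂Hom_apply _ _ hω, map_one, map_one,
    mul_one, mul_one] at this

theorem IsIdBoxComult.apply_j₂ (h : L.IsIdBoxComult Δ Φ) (a : CS N ω) :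
    Φ (ZNAlg.j₂ ω (CZ N) L.alg (L.op a)) = ZNAlg.j₂ ω (CZ N) L.double (Δ a) := by
  have := h 1 a
  rwa [← ZNAlg.j₁Hom_apply, ← ZNAlg.j₁Hom_apply, map_one, map_one, one_mul, one_mul] at this

variable {D D' : L.boson.A →⋆ₐ[ℂ] minTensor L.boson.A L.boson.A}

theorem IsBosonComult.apply_zPow (hω : IsPrimitiveRoot ω N) (hD : L.IsBosonComult D)
    (d : ZMod N) : D (L.zPow d) = minTensor.tmul (L.zPow d) (L.zPow d) := by
  obtain ⟨Δ, Φ, ψ, -, hΦ, hψ, rfl⟩ := hD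
  rw [StarAlgHom.comp_apply, zPow, hΦ.apply_j₁ hω]
  exact (hψ.first _).trans (ZNAlg.tmul_j₁_char L.alg L.alg hω d).symm

theorem IsBosonComult.apply_j₂q (hω : IsPrimitiveRoot ω N) (hD : L.IsBosonComult D)
    (i j : ZMod N) :
    D (L.j₂q i j) = ∑ k, minTensor.tmul (L.j₂q i k) (L.zPow (k - i) * L.j₂q k j) := by
  obtain ⟨Δ, Φ, ψ, hΔ, hΦ, hψ, rfl⟩ := hD
  rw [StarAlgHom.comp_apply, j₂q, hΦ.apply_j₂, hΔ, ← ZNAlg.j₂Hom_apply _ _ hω, map_sum, map_sum]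
  refine Finset.sum_congr rfl fun k _ => ?_
  rw [map_mul, map_mul, ZNAlg.j₂Hom_apply, ZNAlg.j₂Hom_apply, hψ.second, hψ.third,
    ZNAlg.sum_tmul_act_delta hω (L.isHomogeneous_op i k), minTensor.tmul_mul_tmul, mul_one]
  rfl

theorem IsBosonComult.unique (hω : IsPrimitiveRoot ω N) (hD : L.IsBosonComult D)
    (hD' : L.IsBosonComult D') : D = D' :=
  StarAlgHom.ext <| mem_of_zPow_mem_of_j₂q_mem hω (C := StarAlgHom.equalizer D D')
    (isClosed_eq (continuous_starAlgHom_restrict L.boson.isClosed D)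
      (continuous_starAlgHom_restrict L.boson.isClosed D'))
    (fun d => (hD.apply_zPow hω d).trans (hD'.apply_zPow hω d).symm)
    (fun i j => (hD.apply_j₂q hω i j).trans (hD'.apply_j₂q hω i j).symm)

end Comult

end EquivariantRep

/-! ### Direct sums of representations -/

section Representation

variable {m n : Type*} [Fintype m] [Fintype n]

theorem IsRepMatrix.fromBlocks {H : Type*} [NormedAddCommGroup H] [InnerProductSpace ℂ H]
    [CompleteSpace H] {A : StarSubalgebra ℂ (H →L[ℂ] H)} {D : A →⋆ₐ[ℂ] minTensor A A}
    {v : Matrix m m A} {w : Matrix n n A} (hv : IsRepMatrix D v) (hw : IsRepMatrix D w) :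
    IsRepMatrix D (Matrix.fromBlocks v 0 0 w) := by
  rintro (i | i) (j | j) <;>
    simp only [Fintype.sum_sum_type, Matrix.fromBlocks_apply₁₁, Matrix.fromBlocks_apply₁₂,
      Matrix.fromBlocks_apply₂₁, Matrix.fromBlocks_apply₂₂, Matrix.zero_apply, minTensor.tmul_zero,
      minTensor.zero_tmul, Finset.sum_const_zero, add_zero, zero_add, map_zero]
  · exact hv i j
  · exact hw i j

variable [DecidableEq m] [DecidableEq n] {R : Type*} [Ring R] [StarRing R]

theorem fromBlocks_mem_unitary {A : Matrix m m R} {B : Matrix n n R}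
    (hA : A ∈ unitary (Matrix m m R)) (hB : B ∈ unitary (Matrix n n R)) :
    Matrix.fromBlocks A 0 0 B ∈ unitary (Matrix (m ⊕ n) (m ⊕ n) R) := by
  rw [Unitary.mem_iff] at *
  simp only [Matrix.star_eq_conjTranspose] at *
  rw [Matrix.fromBlocks_conjTranspose, Matrix.fromBlocks_multiply, Matrix.fromBlocks_multiply]
  simp [hA, hB]

theorem submatrix_mem_unitary {A : Matrix m m R} (hA : A ∈ unitary (Matrix m m R))
    (e : n ≃ m) : A.submatrix e e ∈ unitary (Matrix n n R) := by
  rw [Unitary.mem_iff] at *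
  simp only [Matrix.star_eq_conjTranspose] at *
  rw [Matrix.conjTranspose_submatrix, Matrix.submatrix_mul_equiv, Matrix.submatrix_mul_equiv,
    hA.1, hA.2, Matrix.submatrix_one_equiv]
  exact ⟨rfl, rfl⟩

theorem of_const_mem_unitary [Unique n] {a : R} (ha : a ∈ unitary R) :
    Matrix.of (fun _ _ : n => a) ∈ unitary (Matrix n n R) := by
  rw [Unitary.mem_iff] at *
  constructor <;> ext i j <;> obtain rfl := Subsingleton.elim i j
  · simpa [Matrix.mul_apply] using ha.1
  · simpa [Matrix.mul_apply] using ha.2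

end Representation

/-! ### The representations `t` and `z ⊕ t` -/

namespace EquivariantRep

variable {N : ℕ} [NeZero N] {ω : ℂ} {L : EquivariantRep.{u} N ω}
  {D : L.boson.A →⋆ₐ[ℂ] minTensor L.boson.A L.boson.A}

theorem IsBosonComult.isRepMatrix_t (hω : IsPrimitiveRoot ω N) (hD : L.IsBosonComult D) :
    IsRepMatrix D L.t := by
  intro i j
  rw [t_eq_zPow_mul_j₂q hω, map_mul, hD.apply_zPow hω, hD.apply_j₂q hω, Finset.mul_sum]
  refine Finset.sum_congr rfl fun k _ => ?_
  rw [minTensor.tmul_mul_tmul, t_eq_zPow_mul_j₂q hω, t_eq_zPow_mul_j₂q hω,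
    ← mul_assoc (L.zPow i), zPow_mul hω, add_sub_cancel]

theorem IsBosonComult.isRepMatrix_z (hω : IsPrimitiveRoot ω N) (hD : L.IsBosonComult D) :
    IsRepMatrix D (Matrix.of fun _ _ : Unit => L.z) := by
  intro i j
  simpa only [Matrix.of_apply, Finset.univ_unique, Finset.sum_singleton, zPow_one] using
    hD.apply_zPow hω 1

theorem IsBosonComult.isRepMatrix_zt (hω : IsPrimitiveRoot ω N) (hD : L.IsBosonComult D) :
    IsRepMatrix D L.zt :=
  (hD.isRepMatrix_z hω).fromBlocks (hD.isRepMatrix_t hω)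

theorem star_t_apply (hω : IsPrimitiveRoot ω N) (i j : ZMod N) :
    star (L.t i j) = L.t (-i) (-j) := by
  rw [t_eq_zPow_mul_j₂q hω, star_mul, (anyonicFamily_j₂q hω).adj, star_zPow hω, smul_mul_assoc,
    j₂q_mul_zPow hω, smul_smul, ← zpw_add hω, ← t_eq_zPow_mul_j₂q hω]
  rw [show -(i * (i - j)) + -((-j - -i) * -i) = 0 by ring, zpw_zero, one_smul]

theorem z_mem_unitary (hω : IsPrimitiveRoot ω N) (L : EquivariantRep.{u} N ω) :
    L.z ∈ unitary L.boson.A := by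
  rw [Unitary.mem_iff, ← zPow_one, star_zPow hω, zPow_mul hω, zPow_mul hω, add_neg_cancel,
    neg_add_cancel, zPow_zero]
  exact ⟨rfl, rfl⟩

theorem t_mem_unitary (hω : IsPrimitiveRoot ω N) (L : EquivariantRep.{u} N ω) :
    L.t ∈ unitary (Matrix (ZMod N) (ZMod N) L.boson.A) := by
  have hq := anyonicFamily_j₂q (L := L) hω
  rw [Unitary.mem_iff]
  constructor
  · ext1 i j
    rw [Matrix.mul_apply, Matrix.one_apply, ← hq.sum_star_mul]
    refine Finset.sum_congr rfl fun k _ => ?_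
    rw [Matrix.star_apply, t_eq_zPow_mul_j₂q hω, t_eq_zPow_mul_j₂q hω, star_mul, mul_assoc,
      ← mul_assoc (star (L.zPow k)), star_zPow hω, zPow_mul hω, neg_add_cancel, zPow_zero, one_mul]
  · ext1 i j
    have h : ∑ k, L.t i k * star (L.t j k) =
        L.zPow i * (∑ k, L.j₂q i k * star (L.j₂q j k)) * star (L.zPow j) := by
      simp only [Finset.mul_sum, Finset.sum_mul, t_eq_zPow_mul_j₂q hω, star_mul, mul_assoc]
    rw [Matrix.mul_apply, Matrix.one_apply]
    refine h.trans ?_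
    rw [hq.sum_mul_star hω]
    split_ifs with hij
    · rw [hij, mul_one, star_zPow hω, zPow_mul hω, add_neg_cancel, zPow_zero]
    · rw [mul_zero, zero_mul]

theorem zt_mem_unitary (hω : IsPrimitiveRoot ω N) (L : EquivariantRep.{u} N ω) :
    L.zt ∈ unitary (Matrix (Unit ⊕ ZMod N) (Unit ⊕ ZMod N) L.boson.A) :=
  fromBlocks_mem_unitary (of_const_mem_unitary (L.z_mem_unitary hω)) (L.t_mem_unitary hω)

theorem zt_map_star_mem_unitary (hω : IsPrimitiveRoot ω N) (L : EquivariantRep.{u} N ω) :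
    L.zt.map star ∈ unitary (Matrix (Unit ⊕ ZMod N) (Unit ⊕ ZMod N) L.boson.A) := by
  have h : L.zt.map star = Matrix.fromBlocks (Matrix.of fun _ _ : Unit => star L.z) 0 0
      (L.t.submatrix (Equiv.neg (ZMod N)) (Equiv.neg (ZMod N))) := by
    ext1 i j
    rcases i with i | i <;> rcases j with j | j
    exacts [rfl, star_zero _, star_zero _, star_t_apply hω i j]
  rw [h]
  exact fromBlocks_mem_unitary (of_const_mem_unitary (Unitary.star_mem (L.z_mem_unitary hω)))
    (submatrix_mem_unitary (L.t_mem_unitary hω) _)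

theorem dense_adjoin_zt (hω : IsPrimitiveRoot ω N) (L : EquivariantRep.{u} N ω) :
    Dense (StarAlgebra.adjoin ℂ {a : L.boson.A | ∃ i j, a = L.zt i j} : Set L.boson.A) := by
  set C := (StarAlgebra.adjoin ℂ {a : L.boson.A | ∃ i j, a = L.zt i j}).topologicalClosure
  have hzt (i j : Unit ⊕ ZMod N) : L.zt i j ∈ C :=
    StarSubalgebra.le_topologicalClosure _ (StarAlgebra.subset_adjoin ℂ _ ⟨i, j, rfl⟩)
  have hz (d : ZMod N) : L.zPow d ∈ C := by
    rw [zPow_eq_pow hω]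
    exact pow_mem (hzt (Sum.inl ()) (Sum.inl ())) _
  refine mem_of_zPow_mem_of_j₂q_mem (C := C) hω (StarSubalgebra.isClosed_topologicalClosure _) hz
    fun i j => ?_
  have h : L.j₂q i j = L.zPow (-i) * L.t i j := by
    rw [t_eq_zPow_mul_j₂q hω, ← mul_assoc, zPow_mul hω, neg_add_cancel, zPow_zero, one_mul]
  rw [h]
  exact mul_mem (hz _) (hzt (Sum.inr i) (Sum.inr j))

end EquivariantRep

end

theorem corollary3 (N : ℕ) [NeZero N] (ω : ℂ) (hω : IsPrimitiveRoot ω N)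
    (L : EquivariantRep.{u} N ω) :
    (∃! D : L.boson.A →⋆ₐ[ℂ] minTensor L.boson.A L.boson.A, L.IsBosonComult D) ∧
      ∀ D : L.boson.A →⋆ₐ[ℂ] minTensor L.boson.A L.boson.A, L.IsBosonComult D →
        IsUnitaryRep D L.t ∧ IsCompactMatrixQuantumGroup L.boson.A D L.zt := by
  obtain ⟨D₀, hD₀⟩ := L.exists_isBosonComult hω
  refine ⟨⟨D₀, hD₀, fun D hD => hD.unique hω hD₀⟩, fun D hD =>
    ⟨⟨L.t_mem_unitary hω, hD.isRepMatrix_t hω⟩, ?_⟩⟩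
  exact
    { isClosed := L.boson.isClosed
      dense := L.dense_adjoin_zt hω
      rep := hD.isRepMatrix_zt hω
      isUnit := ⟨Unitary.toUnits ⟨L.zt, L.zt_mem_unitary hω⟩, rfl⟩
      isUnit_conj := ⟨Unitary.toUnits ⟨_, L.zt_map_star_mem_unitary hω⟩, rfl⟩ }
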